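/- **Privacy of the Empirically Rescaled Gaussian Mechanism.** For a data set $x=(x_1,\dots,x_{3n})\in\mathbb{R}^{3n\times d}$ let $$\mu_x=\frac1n\sum_{i=1}^n x_{i+2n},\qquad \Sigma_x=\frac1{2n}\sum_{i=1}^n (x_i-x_{i+n})(x_i-x_{i+n})^T,$$ and for $\lambda\in\mathbb{R}$ let $\mathcal{G}(\lambda)$ be the set of all $x\in\mathbb{R}^{3n\times d}$ such that $\Sigma_x$ is invertible and $(x_i-\mu_x)^T\Sigma_x^{-1}(x_i-\mu_x)\le\lambda$ for all $i\in[3n]$. Let $D_H(x,y)=|\{i: x_i\ne y_i\}|$ be the Hamming distance, and $D_H(x,S)=\min_{z\in S}D_H(x,z)$, with $D_H(x,\emptyset)=\infty$. Given $\varepsilon,\delta,\beta>0$ and constants $K,c>0$, set $$\lambda=c\,d\log\frac n\beta,\quad t=\frac1\varepsilon\log\frac1\beta,\quad k=\frac2\varepsilon\log\frac1{\delta\beta}+1,\quad C^2=\frac{32k^2}{\varepsilon^2n^2}\cdot\frac{\lambda}{1-2k\lambda/n}\cdot\log\frac{1.25}{\delta}.$$ The mechanism $\mathcal{A}$ with constants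 $K,c$ does the following on input $x$. 1. If $n<K\cdot\frac{k\lambda}{\varepsilon}\log\frac1\delta$, return FAIL. 2. Let $\bar x$ be a uniformly random permutation of the records of $x$, and let $h=D_H(\bar x,\mathcal{G}(\lambda))$. 3. Draw $r\sim\mathrm{Lap}(1/\varepsilon)$ (density $\frac{\varepsilon}{2}e^{-\varepsilon|r|}$). If $h+r>t$, return FAIL. 4. Let $\tilde x\in\arg\min_{z\in\mathcal{G}(\lambda)}D_H(\bar x,z)$, where ties are broken by an arbitrary fixed rule depending on $\bar x$, and return a sample of $\mathcal{N}(\mu_{\tilde x},C^2\Sigma_{\tilde x})$. (If $C^2\le 0$ or $C^2$ involves a division by zero, return $\mu_{\tilde x}$.) There is an absolute constant $K_0>0$ such that for all $K\ge K_0$ and $c>0$, all $n$ and $d$, all $\varepsilon>0$, $0<\delta<1$, $\beta>0$, and every tie-breaking rule, $\mathcal{A}$ is $(3\varepsilon,\,e^{\varepsilon}(1+e^{\varepsilon})\delta)$-differentially private: for all data sets $x,y$ with $D_H(x,y)\le1$, and every measurable set $E\subseteq\mathbb{R}^d\cup\{\mathrm{FAIL}\}$, $$\Pr[\mathcal{A}(x)\in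 E]\le e^{3\varepsilon}\Pr[\mathcal{A}(y)\in E]+e^{\varepsilon}(1+e^{\varepsilon})\delta,$$ and the same with $x$ and $y$ exchanged. The same holds for all $x,y$ that differ in at most one record as multisets, i.e. for which some reordering $y'$ of the records of $y$ satisfies $D_H(x,y')\le 1$. -/

import Mathlib

open MeasureTheory ProbabilityTheory
open scoped ENNReal

/-! ### Differential privacy -/

/-- `(ε, δ)`-indistinguishability of two distributions `P`, `Q` on the same space. -/
def Indistinguishable {W : Type*} [MeasurableSpace W] (ε δ : ℝ) (P Q : Measure W) : Prop :=
  ∀ E : Set W, MeasurableSet E →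
    P E ≤ ENNReal.ofReal (Real.exp ε) * Q E + ENNReal.ofReal δ ∧
    Q E ≤ ENNReal.ofReal (Real.exp ε) * P E + ENNReal.ofReal δ

/-- `(ε, δ)`-differential privacy with respect to a neighboring relation `nbr`, for a randomized
algorithm `A` (`A x` is the distribution of the output on input `x`). -/
def IsDifferentiallyPrivate {X W : Type*} [MeasurableSpace W] (nbr : X → X → Prop)
    (ε δ : ℝ) (A : X → Measure W) : Prop :=
  ∀ x y : X, nbr x y → Indistinguishable ε δ (A x) (A y)

/-! ### Data sets and the Hamming distance -/

/-- Data sets of `m` records, each a point of `ℝ^d`. -/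
abbrev DataSet (m d : ℕ) : Type := Fin m → EuclideanSpace ℝ (Fin d)

open Classical in
/-- The Hamming distance `D_H(x, y) = |{i : x_i ≠ y_i}|`. -/
noncomputable def dataDist {m d : ℕ} (x y : DataSet m d) : ℕ := hammingDist x y

/-- The Hamming distance `D_H(x, S) = min_{z ∈ S} D_H(x, z)` to a set; it is `⊤` for `S = ∅`. -/
noncomputable def dataDistToSet {m d : ℕ} (x : DataSet m d) (S : Set (DataSet m d)) : ℕ∞ :=
  ⨅ z ∈ S, (dataDist x z : ℕ∞)

/-- Neighboring data sets: `D_H(x, y) ≤ 1`. -/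
def Neighboring {m d : ℕ} (x y : DataSet m d) : Prop := dataDist x y ≤ 1

/-- Data sets that, regarded as multisets of records, differ in at most one record: some
reordering of the records of `y` has Hamming distance at most one from `x`. -/
def MultisetNeighboring {m d : ℕ} (x y : DataSet m d) : Prop :=
  ∃ π : Equiv.Perm (Fin m), dataDist x (y ∘ π) ≤ 1

/-! ### Empirical mean and covariance, goodness -/

/-- `μ_x = (1/n) ∑_{i=1}^n x_{i+2n}`. -/
noncomputable def empMean {n d : ℕ} (x : DataSet (3 * n) d) : EuclideanSpace ℝ (Fin d) :=
  (1 / (n : ℝ)) • ∑ i : Fin n, x ⟨i + 2 * n, by omega⟩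

/-- The paired difference `x_i - x_{i+n}`, for `1 ≤ i ≤ n`. -/
noncomputable def pairDiff {n d : ℕ} (x : DataSet (3 * n) d) (i : Fin n) :
    EuclideanSpace ℝ (Fin d) :=
  x ⟨i, by omega⟩ - x ⟨i + n, by omega⟩

/-- `Σ_x = (1/(2n)) ∑_{i=1}^n (x_i - x_{i+n}) (x_i - x_{i+n})ᵀ`. -/
noncomputable def empCov {n d : ℕ} (x : DataSet (3 * n) d) : Matrix (Fin d) (Fin d) ℝ :=
  (1 / (2 * (n : ℝ))) • ∑ i : Fin n, Matrix.vecMulVec (pairDiff x i).ofLp (pairDiff x i).ofLp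

/-- The squared Mahalanobis norm `‖v‖_S² = vᵀ S⁻¹ v` (used for invertible `S` only). -/
noncomputable def mahalanobisSq {d : ℕ} (S : Matrix (Fin d) (Fin d) ℝ)
    (v : EuclideanSpace ℝ (Fin d)) : ℝ :=
  v.ofLp ⬝ᵥ (S⁻¹).mulVec v.ofLp

/-- The set `G(lam)` of `lam`-good data sets. -/
def goodSet (n d : ℕ) (lam : ℝ) : Set (DataSet (3 * n) d) :=
  {x | IsUnit (empCov x) ∧ ∀ i, mahalanobisSq (empCov x) (x i - empMean x) ≤ lam}

/-- `proj` is a nearest-point projection onto `S` in Hamming distance, that is,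
`proj x ∈ argmin_{z ∈ S} D_H(x, z)` with ties broken in any way (no condition if `S = ∅`). -/
def IsProjection {m d : ℕ} (S : Set (DataSet m d)) (proj : DataSet m d → DataSet m d) : Prop :=
  S.Nonempty → ∀ x, proj x ∈ S ∧ ∀ z ∈ S, dataDist x (proj x) ≤ dataDist x z

/-- Such projections exist. -/
theorem exists_isProjection {m d : ℕ} (S : Set (DataSet m d)) : ∃ proj, IsProjection S proj := by
  by_cases hS : S.Nonempty
  · have h : ∀ x : DataSet m d, ∃ p, p ∈ S ∧ ∀ z ∈ S, dataDist x p ≤ dataDist x z := fun x =>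
      ⟨Function.argminOn (dataDist x) S hS, Function.argminOn_mem _ _ _,
        fun z hz => Function.argminOn_le _ _ hz⟩
    choose p hp using h
    exact ⟨p, fun _ => hp⟩
  · exact ⟨id, fun h => absurd h hS⟩

/-! ### Noise distributions -/

/-- The centered Laplace distribution `Lap(b)`, with density `exp (-|r| / b) / (2 b)`. -/
noncomputable def laplace (b : ℝ) : Measure ℝ :=
  volume.withDensity fun r => ENNReal.ofReal (Real.exp (-|r| / b) / (2 * b))

theorem isProbabilityMeasure_laplace {b : ℝ} (hb : 0 < b) : IsProbabilityMeasure (laplace b) := by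
  constructor
  have hI : ∫ r : ℝ, Real.exp (-|r| / b) / (2 * b) = 1 := by
    have h1 : ∫ r : ℝ, Real.exp (-|r| / b) / (2 * b)
        = 2 * ∫ r in Set.Ioi (0 : ℝ), Real.exp (-r / b) / (2 * b) :=
      integral_comp_abs (f := fun r => Real.exp (-r / b) / (2 * b))
    have h2 : ∫ r in Set.Ioi (0 : ℝ), Real.exp (-r / b) = b := by
      have := integral_exp_mul_Ioi (a := -b⁻¹) (by simpa using hb) 0
      simpa [div_eq_mul_inv, mul_comm] using this
    rw [h1, integral_div, h2]
    field_simp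
  have hint : Integrable (fun r : ℝ => Real.exp (-|r| / b) / (2 * b)) := by
    by_contra hc
    rw [integral_undef hc] at hI
    exact zero_ne_one hI
  rw [laplace, withDensity_apply _ MeasurableSet.univ, Measure.restrict_univ,
    ← ofReal_integral_eq_lintegral_ofReal hint (Filter.Eventually.of_forall fun r => by positivity),
    hI, ENNReal.ofReal_one]

/-! ### The Empirically Rescaled Gaussian Mechanism -/

/-- Outputs of the mechanism: a point of `ℝ^d`, or `FAIL`. -/
abbrev Output (d : ℕ) : Type := EuclideanSpace ℝ (Fin d) ⊕ Unit

/-- The output `FAIL`. -/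
abbrev outFail {d : ℕ} : Output d := Sum.inr ()

/-- `λ = c · d · log (n / β)`, where `c` is the constant hidden in `λ = O(d log (n / β))`. -/
noncomputable def lamParam (c : ℝ) (n d : ℕ) (β : ℝ) : ℝ := c * (d * Real.log (n / β))

/-- `t = (1/ε) log (1/β)`. -/
noncomputable def tParam (ε β : ℝ) : ℝ := 1 / ε * Real.log (1 / β)

/-- `k = (2/ε) log (1/(δβ)) + 1`. -/
noncomputable def kParam (ε δ β : ℝ) : ℝ := 2 / ε * Real.log (1 / (δ * β)) + 1

/-- `C² = (32 k² / (ε² n²)) · (λ / (1 - 2kλ/n)) · log (1.25/δ)`. -/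
noncomputable def noiseScaleSq (n : ℕ) (ε δ lam k : ℝ) : ℝ :=
  32 * k ^ 2 / (ε ^ 2 * (n : ℝ) ^ 2) * (lam / (1 - 2 * k * lam / n)) * Real.log (1.25 / δ)

/-- The steps after the permutation, run on the permuted data set `x`: with
`h = D_H(x, G(lam))` and `r ∼ Lap(1/ε)`, return `FAIL` if `h + r > t` (in particular if
`h = ∞`); otherwise return a sample of `N(μ_z, C² Σ_z)`, where `z = proj x`.
(`multivariateGaussian μ S` is the point mass at `μ` when `S` is not positive semidefinite.) -/
noncomputable def afterPermutation {n d : ℕ} (ε t lam Csq : ℝ)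
    (proj : DataSet (3 * n) d → DataSet (3 * n) d) (x : DataSet (3 * n) d) : Measure (Output d) :=
  open Classical in
  (laplace (1 / ε)).bind fun r =>
    if dataDistToSet x (goodSet n d lam) = ⊤ ∨
        ((dataDistToSet x (goodSet n d lam)).toNat : ℝ) + r > t then
      Measure.dirac outFail
    else
      (multivariateGaussian (empMean (proj x)) (Csq • empCov (proj x))).map Sum.inl

/-- The distribution of the output of the Empirically Rescaled Gaussian Mechanism on the data set
`x`. The constant `K` is the one hidden in the sample size test
`n = o((k λ / ε) log (1/δ))`, and `c` is the one hidden in `λ`. -/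
noncomputable def rescaledGaussian (K c : ℝ) {n d : ℕ} (ε δ β : ℝ)
    (proj : DataSet (3 * n) d → DataSet (3 * n) d) (x : DataSet (3 * n) d) : Measure (Output d) :=
  let lam := lamParam c n d β
  let t := tParam ε β
  let k := kParam ε δ β
  let Csq := noiseScaleSq n ε δ lam k
  open Classical in
  if (n : ℝ) < K * (k * lam / ε * Real.log (1 / δ)) then
    Measure.dirac outFail
  else
    -- uniformly random permutation of the records
    ∑ σ : Equiv.Perm (Fin (3 * n)),
      (Fintype.card (Equiv.Perm (Fin (3 * n))) : ℝ≥0∞)⁻¹ •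
        afterPermutation ε t lam Csq proj (x ∘ σ)

theorem isProbabilityMeasure_afterPermutation {n d : ℕ} {ε : ℝ} (hε : 0 < ε) (t lam Csq : ℝ)
    (proj : DataSet (3 * n) d → DataSet (3 * n) d) (x : DataSet (3 * n) d) :
    IsProbabilityMeasure (afterPermutation ε t lam Csq proj x) := by
  classical
  have := isProbabilityMeasure_laplace (one_div_pos.mpr hε)
  unfold afterPermutation
  refine isProbabilityMeasure_bind (Measurable.aemeasurable ?_) (Filter.Eventually.of_forall ?_)
  · refine Measurable.ite ?_ measurable_const measurable_const
    refine MeasurableSet.union (MeasurableSet.const _) ?_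
    exact measurableSet_lt measurable_const (measurable_const.add measurable_id)
  · intro r
    split_ifs
    · infer_instance
    · exact Measure.isProbabilityMeasure_map measurable_inl.aemeasurable

/-- The mechanism is a randomized algorithm: its output has a probability distribution. -/
theorem isProbabilityMeasure_rescaledGaussian (K c : ℝ) {n d : ℕ} {ε : ℝ} (hε : 0 < ε) (δ β : ℝ)
    (proj : DataSet (3 * n) d → DataSet (3 * n) d) (x : DataSet (3 * n) d) :
    IsProbabilityMeasure (rescaledGaussian K c ε δ β proj x) := by
  classical
  unfold rescaledGaussian
  dsimp only
  split_ifs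
  · infer_instance
  · constructor
    have h := fun y => (isProbabilityMeasure_afterPermutation hε (tParam ε β) (lamParam c n d β)
      (noiseScaleSq n ε δ (lamParam c n d β) (kParam ε δ β)) proj y).measure_univ
    simp only [Measure.coe_finsetSum, Finset.sum_apply, Measure.smul_apply, h, smul_eq_mul,
      mul_one, Finset.sum_const, Finset.card_univ, nsmul_eq_mul]
    exact ENNReal.mul_inv_cancel (by simp [Fintype.card_ne_zero]) (ENNReal.natCast_ne_top _)

/-! ### Moment bounds on the privacy loss of product measures -/

/-! Coupling the runs on `x` and `y` through the same permutation preserves Hamming distance, so it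
suffices to compare the steps after the permutation (`uniform_mixture_le`). The output law does not
depend on the order of the records, which gives the multiset version for free.

After the permutation (`afterPermutation_le`), the distance to the good set is 1-Lipschitz, so the
Laplace test costs a factor `e^ε`. If both distances are at most `t + log (1/δ) / ε`, the two
projections differ in at most `k` records, by the triangle inequality. Otherwise the test passes
with probability at most `e^ε δ`.

It remains to compare the Gaussians of two good data sets `z`, `w` that differ in at most `k`
records (`releaseGaussian_le`). Choose coordinates in which `Σ_z` is the identity and `Σ_w` is
diagonal with entries `D i`. In a good data set no record carries much weight, and with `γ = 2kλ/n`
this gives `∑ |1 - 1 / D i| ≤ 3γ` and a mean shift of order `k √λ / n` (`cov_ratio_bounds`,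
`mean_shift_bound`). The bound on the sum, not just on each term, is what avoids a further loss in
the dimension.

Changing first the mean and then the covariance costs `(ε, δ)` each, and the two compose to `(2ε, (1
+ e^ε)δ)` (`multivariateGaussian_le`). Both costs come from Markov's inequality for an exponential
moment of the privacy loss, of order `α = 2 log (1/δ) / ε`; such moments factor over coordinates.
The sample size test makes `γ log (1/δ)` small against `ε`, which pays for the covariance, and `C²`
is calibrated to pay for the mean. -/

theorem lintegral_pi_prod_eq_prod {ι : Type*} [Fintype ι] (μ : ι → Measure ℝ)
    [∀ i, IsProbabilityMeasure (μ i)] (f : ι → ℝ → ℝ≥0∞) (hf : ∀ i, Measurable (f i)) :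
    ∫⁻ x, ∏ i, f i (x i) ∂Measure.pi μ = ∏ i, ∫⁻ x, f i x ∂μ i := by
  refine (lintegral_prod_eq_prod_lintegral_of_indepFun Finset.univ
    (fun i (x : ι → ℝ) => f i (x i)) (iIndepFun_pi (μ := μ) fun i => (hf i).aemeasurable)
    (fun i => (hf i).comp (measurable_pi_apply i))).trans ?_
  refine Finset.prod_congr rfl fun i _ => ?_
  rw [← (measurePreserving_eval μ i).lintegral_comp (hf i)]

theorem pi_eq_withDensity_prod {ι : Type*} [Fintype ι] (P Q : ι → Measure ℝ)
    [∀ i, IsProbabilityMeasure (P i)] [∀ i, IsProbabilityMeasure (Q i)]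
    (f : ι → ℝ → ℝ≥0∞) (hf : ∀ i, Measurable (f i)) (hPQ : ∀ i, P i = (Q i).withDensity (f i)) :
    Measure.pi P = (Measure.pi Q).withDensity fun x => ∏ i, f i (x i) := by
  refine Measure.pi_eq fun s hs => ?_
  rw [withDensity_apply _ (MeasurableSet.univ_pi hs), ← lintegral_indicator (MeasurableSet.univ_pi hs)]
  have h : (Set.univ.pi s).indicator (fun x => ∏ i, f i (x i))
      = fun x => ∏ i, (s i).indicator (f i) (x i) := by
    ext x
    by_cases hx : x ∈ Set.univ.pi s
    · rw [Set.indicator_of_mem hx]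
      exact Finset.prod_congr rfl fun i _ => by
        rw [Set.indicator_of_mem (hx i (Set.mem_univ i))]
    · rw [Set.indicator_of_notMem hx]
      simp only [Set.mem_pi, Set.mem_univ, true_imp_iff, not_forall] at hx
      obtain ⟨i, hi⟩ := hx
      exact (Finset.prod_eq_zero (Finset.mem_univ i) (Set.indicator_of_notMem hi _)).symm
  rw [h, lintegral_pi_prod_eq_prod Q _ fun i => (hf i).indicator (hs i)]
  refine Finset.prod_congr rfl fun i _ => ?_
  rw [lintegral_indicator (hs i), hPQ, withDensity_apply _ (hs i)]

/-- Markov's inequality for the privacy loss `g`. -/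
theorem le_exp_mul_add_of_moment {Ω : Type*} [MeasurableSpace Ω] (P Q : Measure Ω)
    (g : Ω → ℝ) (hg : Measurable g)
    (hPQ : P = Q.withDensity fun x => ENNReal.ofReal (Real.exp (g x))) {α ε δ : ℝ} (hα : 0 < α)
    (hmom : ∫⁻ x, ENNReal.ofReal (Real.exp (α * g x)) ∂P ≤ ENNReal.ofReal (Real.exp (α * ε) * δ))
    (E : Set Ω) (hE : MeasurableSet E) :
    P E ≤ ENNReal.ofReal (Real.exp ε) * Q E + ENNReal.ofReal δ := by
  have hS : MeasurableSet {x | g x < ε} := measurableSet_lt hg measurable_const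
  have h1 : P (E ∩ {x | g x < ε}) ≤ ENNReal.ofReal (Real.exp ε) * Q E := by
    rw [hPQ, withDensity_apply _ (hE.inter hS)]
    calc ∫⁻ x in E ∩ {x | g x < ε}, ENNReal.ofReal (Real.exp (g x)) ∂Q
        ≤ ∫⁻ _ in E ∩ {x | g x < ε}, ENNReal.ofReal (Real.exp ε) ∂Q := by
          refine setLIntegral_mono measurable_const fun x hx => ?_
          exact ENNReal.ofReal_le_ofReal (Real.exp_le_exp.2 (le_of_lt hx.2))
      _ = ENNReal.ofReal (Real.exp ε) * Q (E ∩ {x | g x < ε}) := setLIntegral_const _ _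
      _ ≤ _ := by gcongr; exact Set.inter_subset_left
  have h2 : P {x | ε ≤ g x} ≤ ENNReal.ofReal δ := by
    have hm := mul_meas_ge_le_lintegral (μ := P)
      (f := fun x => ENNReal.ofReal (Real.exp (α * g x))) (by fun_prop)
      (ENNReal.ofReal (Real.exp (α * ε)))
    have hset : {x | ENNReal.ofReal (Real.exp (α * ε)) ≤ ENNReal.ofReal (Real.exp (α * g x))}
        = {x | ε ≤ g x} := by
      ext x
      simp only [Set.mem_ofPred_eq]
      rw [ENNReal.ofReal_le_ofReal_iff (Real.exp_nonneg _), Real.exp_le_exp,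
        mul_le_mul_iff_right₀ hα]
    rw [hset] at hm
    have h3 := hm.trans hmom
    rw [ENNReal.ofReal_mul (Real.exp_nonneg _)] at h3
    exact (ENNReal.mul_le_mul_iff_right (by simp [Real.exp_pos]) ENNReal.ofReal_ne_top).1 h3
  calc P E ≤ P ((E ∩ {x | g x < ε}) ∪ {x | ε ≤ g x}) := by
        refine measure_mono fun x hx => ?_
        rcases lt_or_ge (g x) ε with h | h
        · exact Or.inl ⟨hx, h⟩
        · exact Or.inr h
    _ ≤ _ := (measure_union_le _ _).trans (add_le_add h1 h2)

/-- For product measures the privacy loss is a sum of independent terms, so its exponential moment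
is the product of the one-dimensional ones. -/
theorem pi_le_exp_mul_add_of_moment {ι : Type*} [Fintype ι] (P Q : ι → Measure ℝ)
    [∀ i, IsProbabilityMeasure (P i)] [∀ i, IsProbabilityMeasure (Q i)]
    (g : ι → ℝ → ℝ) (hg : ∀ i, Measurable (g i))
    (hPQ : ∀ i, P i = (Q i).withDensity fun x => ENNReal.ofReal (Real.exp (g i x)))
    {α ε δ : ℝ} (hα : 0 < α) (b : ι → ℝ)
    (hmom : ∀ i, ∫⁻ x, ENNReal.ofReal (Real.exp (α * g i x)) ∂P i
      ≤ ENNReal.ofReal (Real.exp (b i)))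
    (hb : Real.exp (∑ i, b i) ≤ Real.exp (α * ε) * δ)
    (E : Set (ι → ℝ)) (hE : MeasurableSet E) :
    Measure.pi P E ≤ ENNReal.ofReal (Real.exp ε) * Measure.pi Q E + ENNReal.ofReal δ := by
  have hexp : ∀ (c : ℝ) (x : ι → ℝ), ENNReal.ofReal (Real.exp (c * ∑ i, g i (x i)))
      = ∏ i, ENNReal.ofReal (Real.exp (c * g i (x i))) := fun c x => by
    rw [Finset.mul_sum, Real.exp_sum, ENNReal.ofReal_prod_of_nonneg fun i _ => Real.exp_nonneg _]
  refine le_exp_mul_add_of_moment _ _ (fun x => ∑ i, g i (x i))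
    (by fun_prop) ?_ hα ?_ E hE
  · rw [pi_eq_withDensity_prod P Q _ (fun i => by have := hg i; fun_prop) hPQ]
    congr 1
    ext x
    simpa using (hexp 1 x).symm
  · simp_rw [hexp α]
    rw [lintegral_pi_prod_eq_prod P (fun i x => ENNReal.ofReal (Real.exp (α * g i x)))
      (fun i => by have := hg i; fun_prop)]
    refine (Finset.prod_le_prod' fun i _ => hmom i).trans ?_
    rw [← ENNReal.ofReal_prod_of_nonneg fun i _ => Real.exp_nonneg _, ← Real.exp_sum]
    exact ENNReal.ofReal_le_ofReal hb

/-! ### One-dimensional Gaussian measures -/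

theorem gaussianReal_eq_withDensity_shift (m : ℝ) :
    gaussianReal m 1 = (gaussianReal 0 1).withDensity
      fun x => ENNReal.ofReal (Real.exp (m * x - m ^ 2 / 2)) := by
  rw [gaussianReal_of_var_ne_zero _ one_ne_zero, gaussianReal_of_var_ne_zero _ one_ne_zero,
    ← withDensity_mul _ (measurable_gaussianPDF _ _) (by fun_prop)]
  congr 1
  ext x
  rw [Pi.mul_apply, gaussianPDF, gaussianPDF, ← ENNReal.ofReal_mul (gaussianPDFReal_nonneg _ _ _),
    gaussianPDFReal, gaussianPDFReal, mul_assoc _ (Real.exp _), ← Real.exp_add]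
  congr 3
  simp only [NNReal.coe_one]
  ring

theorem gaussianReal_eq_withDensity_scale {v : ℝ} (hv : 0 < v) :
    gaussianReal 0 1 = (gaussianReal 0 v.toNNReal).withDensity
      fun x => ENNReal.ofReal (Real.exp (Real.log v / 2 - (1 - 1 / v) / 2 * x ^ 2)) := by
  have hv' : v.toNNReal ≠ 0 := by simpa using hv
  rw [gaussianReal_of_var_ne_zero _ one_ne_zero, gaussianReal_of_var_ne_zero _ hv',
    ← withDensity_mul _ (measurable_gaussianPDF _ _) (by fun_prop)]
  congr 1
  ext x
  rw [Pi.mul_apply, gaussianPDF, gaussianPDF, ← ENNReal.ofReal_mul (gaussianPDFReal_nonneg _ _ _),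
    gaussianPDFReal, gaussianPDFReal, mul_assoc _ (Real.exp _), ← Real.exp_add, Real.coe_toNNReal _ hv.le]
  have h1 : Real.exp (Real.log v / 2) = √v := by
    rw [Real.sqrt_eq_rpow, Real.rpow_def_of_pos hv]; congr 1; ring
  have h2 : -(x - 0) ^ 2 / (2 * v) + (Real.log v / 2 - (1 - 1 / v) / 2 * x ^ 2)
      = Real.log v / 2 + -(x - 0) ^ 2 / (2 * 1) := by
    field_simp
    ring
  rw [h2, Real.exp_add, h1, Real.sqrt_mul (by positivity) v, NNReal.coe_one, mul_one]
  have : √v ≠ 0 := (Real.sqrt_pos.2 hv).ne'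
  congr 1
  field_simp

theorem lintegral_exp_shift_gaussianReal (m α : ℝ) :
    ∫⁻ x, ENNReal.ofReal (Real.exp (α * (m * x - m ^ 2 / 2))) ∂gaussianReal m 1
      = ENNReal.ofReal (Real.exp ((α + α ^ 2) / 2 * m ^ 2)) := by
  have h0 : ∀ x : ℝ, Real.exp (α * (m * x - m ^ 2 / 2))
      = Real.exp (α * m * x) * Real.exp (-(α * m ^ 2 / 2)) := fun x => by
    rw [← Real.exp_add]; congr 1; ring
  rw [← ofReal_integral_eq_lintegral_ofReal]
  · have := congrFun (mgf_fun_id_gaussianReal (μ := m) (v := 1)) (α * m)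
    rw [mgf] at this
    simp_rw [h0]
    rw [integral_mul_const, this, ← Real.exp_add]
    congr 2
    simp only [NNReal.coe_one]
    ring
  · simp_rw [h0]
    exact (integrable_exp_mul_gaussianReal _).mul_const _
  · exact Filter.Eventually.of_forall fun _ => Real.exp_nonneg _

theorem lintegral_exp_neg_sq_gaussianReal {s : ℝ} (hs : 0 < 1 + s) :
    ∫⁻ x, ENNReal.ofReal (Real.exp (-(s / 2 * x ^ 2))) ∂gaussianReal 0 1
      = ENNReal.ofReal (Real.exp (-Real.log (1 + s) / 2)) := by
  -- Relative to the Gaussian of variance `(1 + s)⁻¹` the integrand becomes constant, so no integral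
  -- has to be computed.
  have hw : 0 < (1 + s)⁻¹ := inv_pos.2 hs
  conv_lhs => rw [gaussianReal_eq_withDensity_scale hw]
  rw [lintegral_withDensity_eq_lintegral_mul _ (by fun_prop) (by fun_prop)]
  have h : ∀ x : ℝ, ((fun x : ℝ => ENNReal.ofReal (Real.exp (Real.log (1 + s)⁻¹ / 2
        - (1 - 1 / (1 + s)⁻¹) / 2 * x ^ 2)))
      * fun x : ℝ => ENNReal.ofReal (Real.exp (-(s / 2 * x ^ 2)))) x
      = ENNReal.ofReal (Real.exp (-Real.log (1 + s) / 2)) := fun x => by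
    rw [Pi.mul_apply, ← ENNReal.ofReal_mul (Real.exp_nonneg _), ← Real.exp_add, Real.log_inv]
    congr 2
    field_simp
    ring
  simp_rw [h]
  simp

/-- `log (1 - z) ≥ -z - 2 z²` for `|z| ≤ 1/2`. -/
theorem neg_sub_two_mul_sq_le_log_one_sub {z : ℝ} (hz : |z| ≤ 1 / 2) :
    -z - 2 * z ^ 2 ≤ Real.log (1 - z) := by
  have hz' := abs_le.1 hz
  have hpos : 0 < 1 - z := by linarith
  refine le_trans ?_ (Real.one_sub_inv_le_log_of_pos hpos)
  have : 1 - (1 - z)⁻¹ - (-z - 2 * z ^ 2) = z ^ 2 * (1 - 2 * z) / (1 - z) := by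
    field_simp
    ring
  have h2 : 0 ≤ z ^ 2 * (1 - 2 * z) / (1 - z) :=
    div_nonneg (mul_nonneg (sq_nonneg _) (by linarith)) hpos.le
  linarith

/-- With `u = 1 - 1 / v`, the log-moment is exactly `-(α / 2) log (1 - u) - log (1 + α u) / 2`. The
first-order terms cancel, and what is left is at most `α u² + α² u² ≤ 2 α² u²`. -/
theorem lintegral_exp_scale_gaussianReal_le {v α : ℝ} (hα : 1 ≤ α)
    (h : α * |1 - 1 / v| ≤ 1 / 2) :
    ∫⁻ x, ENNReal.ofReal (Real.exp (α * (Real.log v / 2 - (1 - 1 / v) / 2 * x ^ 2)))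
        ∂gaussianReal 0 1
      ≤ ENNReal.ofReal (Real.exp (2 * (α * |1 - 1 / v|) ^ 2)) := by
  set u := 1 - 1 / v with hu
  have hαu : |α * u| ≤ 1 / 2 := by rwa [abs_mul, abs_of_pos (by linarith)]
  have hu2 : |u| ≤ 1 / 2 := le_trans (le_mul_of_one_le_left (abs_nonneg _) hα) h
  have hlogv : Real.log v = -Real.log (1 - u) := by
    rw [← Real.log_inv]
    congr 1
    rw [hu]
    simp
  have h0 : ∀ x : ℝ, ENNReal.ofReal (Real.exp (α * (Real.log v / 2 - u / 2 * x ^ 2)))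
      = ENNReal.ofReal (Real.exp (α * (Real.log v / 2)))
        * ENNReal.ofReal (Real.exp (-(α * u / 2 * x ^ 2))) := fun x => by
    rw [← ENNReal.ofReal_mul (Real.exp_nonneg _), ← Real.exp_add]
    congr 2
    ring
  simp_rw [h0]
  rw [lintegral_const_mul _ (by fun_prop),
    lintegral_exp_neg_sq_gaussianReal (by linarith [(abs_le.1 hαu).1]),
    ← ENNReal.ofReal_mul (Real.exp_nonneg _), ← Real.exp_add]
  refine ENNReal.ofReal_le_ofReal (Real.exp_le_exp.2 ?_)
  have h1 := neg_sub_two_mul_sq_le_log_one_sub hu2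
  have h2 := neg_sub_two_mul_sq_le_log_one_sub (z := -(α * u)) (by rwa [abs_neg])
  rw [sub_neg_eq_add] at h2
  rw [hlogv, mul_pow, sq_abs]
  have h3 := mul_le_mul_of_nonneg_left h1 (by linarith : 0 ≤ α)
  have h4 : α * u ^ 2 ≤ α ^ 2 * u ^ 2 := by
    apply mul_le_mul_of_nonneg_right _ (sq_nonneg u)
    nlinarith
  nlinarith

/-! ### Products of Gaussian measures -/

theorem pi_gaussianReal_shift_le {ι : Type*} [Fintype ι] (m : ι → ℝ) {α ε δ : ℝ} (hα : 0 < α)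
    (h : Real.exp ((α + α ^ 2) / 2 * ∑ i, m i ^ 2) ≤ Real.exp (α * ε) * δ)
    (E : Set (ι → ℝ)) (hE : MeasurableSet E) :
    Measure.pi (fun i => gaussianReal (m i) 1) E
      ≤ ENNReal.ofReal (Real.exp ε) * Measure.pi (fun _ => gaussianReal 0 1) E
        + ENNReal.ofReal δ :=
  pi_le_exp_mul_add_of_moment _ _ (fun i x => m i * x - m i ^ 2 / 2) (fun i => by fun_prop)
    (fun i => gaussianReal_eq_withDensity_shift (m i)) hα
    (fun i => (α + α ^ 2) / 2 * m i ^ 2)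
    (fun i => (lintegral_exp_shift_gaussianReal (m i) α).le)
    (by rwa [← Finset.mul_sum]) E hE

theorem pi_gaussianReal_scale_le {ι : Type*} [Fintype ι] (v : ι → ℝ) (hv : ∀ i, 0 < v i)
    {α ε δ : ℝ} (hα : 1 ≤ α) (hsmall : α * ∑ i, |1 - 1 / v i| ≤ 1 / 2)
    (h : Real.exp (2 * (α * ∑ i, |1 - 1 / v i|) ^ 2) ≤ Real.exp (α * ε) * δ)
    (E : Set (ι → ℝ)) (hE : MeasurableSet E) :
    Measure.pi (fun _ : ι => gaussianReal 0 1) E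
      ≤ ENNReal.ofReal (Real.exp ε) * Measure.pi (fun i => gaussianReal 0 (v i).toNNReal) E
        + ENNReal.ofReal δ := by
  have hle : ∀ i, |1 - 1 / v i| ≤ ∑ i, |1 - 1 / v i| := fun i =>
    Finset.single_le_sum (f := fun i => |1 - 1 / v i|) (fun _ _ => abs_nonneg _)
      (Finset.mem_univ i)
  refine pi_le_exp_mul_add_of_moment _ _
    (fun i x => Real.log (v i) / 2 - (1 - 1 / v i) / 2 * x ^ 2) (fun i => by fun_prop)
    (fun i => gaussianReal_eq_withDensity_scale (hv i)) (by linarith : 0 < α)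
    (fun i => 2 * (α * |1 - 1 / v i|) ^ 2)
    (fun i => lintegral_exp_scale_gaussianReal_le hα
      ((mul_le_mul_of_nonneg_left (hle i) (by linarith)).trans hsmall)) ?_ E hE
  refine le_trans (Real.exp_le_exp.2 ?_) h
  have hsq : ∑ i, (α * |1 - 1 / v i|) ^ 2 ≤ (∑ i, α * |1 - 1 / v i|) ^ 2 :=
    Finset.sum_sq_le_sq_sum_of_nonneg fun i _ => by positivity
  rw [← Finset.mul_sum, Finset.mul_sum Finset.univ _ α]
  linarith

/-! ### Multivariate Gaussian measures as affine images of products -/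

/-- Compare characteristic functions. Keeping the base point `b` separate from the mean `m` of the
product lets two Gaussians with different means be images under one affine map, so that bounds for
product measures pull back along it. -/
theorem map_affine_pi_gaussianReal {d : ℕ} (μ b : EuclideanSpace ℝ (Fin d))
    (S A : Matrix (Fin d) (Fin d) ℝ) (m v : Fin d → ℝ) (hv : ∀ i, 0 ≤ v i)
    (hS : A * Matrix.diagonal v * A.transpose = S) (hμ : μ.ofLp = b.ofLp + A.mulVec m) :
    (Measure.pi fun i => gaussianReal (m i) (v i).toNNReal).map
      (fun x => WithLp.toLp 2 (b.ofLp + A.mulVec x)) = multivariateGaussian μ S := by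
  have hpsd : S.PosSemidef := by
    rw [← hS]
    exact (Matrix.posSemidef_diagonal_iff.2 hv).mul_mul_conjTranspose_same A
  have hmeas : Measurable fun x : Fin d → ℝ => WithLp.toLp 2 (b.ofLp + A.mulVec x) := by
    fun_prop
  have : IsProbabilityMeasure ((Measure.pi fun i => gaussianReal (m i) (v i).toNNReal).map
      (fun x => WithLp.toLp 2 (b.ofLp + A.mulVec x))) :=
    Measure.isProbabilityMeasure_map hmeas.aemeasurable
  apply Measure.ext_of_charFun
  ext t
  rw [charFun_multivariateGaussian hpsd, charFun_apply,
    integral_map hmeas.aemeasurable (by fun_prop)]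
  set w : EuclideanSpace ℝ (Fin d) := WithLp.toLp 2 (A.transpose.mulVec t.ofLp) with hw
  have h1 : ∀ x : Fin d → ℝ, inner ℝ (WithLp.toLp 2 (b.ofLp + A.mulVec x)) t
      = inner ℝ b t + inner ℝ (WithLp.toLp 2 x) w := fun x => by
    simp only [EuclideanSpace.inner_eq_star_dotProduct, hw, star_trivial, dotProduct_add,
      Matrix.mulVec_transpose, Matrix.dotProduct_mulVec]
  have h2 := charFun_pi (μ := fun i => gaussianReal (m i) (v i).toNNReal) w
  rw [charFun_apply, integral_map (by fun_prop) (by fun_prop)] at h2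
  simp_rw [h1]
  simp only [Complex.ofReal_add, add_mul, Complex.exp_add]
  rw [integral_const_mul, h2]
  simp_rw [charFun_gaussianReal]
  rw [← Complex.exp_sum, ← Complex.exp_add]
  have e1 : (inner ℝ t μ : ℝ) = inner ℝ b t + ∑ i, w i * m i := by
    rw [EuclideanSpace.inner_eq_star_dotProduct, star_trivial, hμ, add_dotProduct,
      EuclideanSpace.inner_eq_star_dotProduct, star_trivial, dotProduct_comm t.ofLp,
      dotProduct_comm (A.mulVec m), Matrix.dotProduct_mulVec, ← Matrix.mulVec_transpose]
    rfl
  have e2 : t.ofLp ⬝ᵥ S.mulVec t.ofLp = ∑ i, v i * w i ^ 2 := by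
    rw [← hS, ← Matrix.mulVec_mulVec, ← Matrix.mulVec_mulVec, Matrix.dotProduct_mulVec,
      ← Matrix.mulVec_transpose]
    simp only [dotProduct, Matrix.mulVec_diagonal, hw]
    exact Finset.sum_congr rfl fun i _ => by ring
  rw [e1, e2]
  congr 1
  push_cast
  rw [add_mul, Finset.sum_mul, Finset.sum_div, add_sub_assoc, ← Finset.sum_sub_distrib]
  congr 1
  refine Finset.sum_congr rfl fun i _ => ?_
  rw [Real.coe_toNNReal _ (hv i)]

/-! ### The Laplace distribution -/

/-- Compare densities after translation. Since `c` may be negative, this covers both the privacy of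
the test (`c = ε`) and the tail bound (`c = -(ε * s)`). -/
theorem laplace_preimage_add_le {b c v : ℝ} (hb : 0 < b) {B : Set ℝ} (hB : MeasurableSet B)
    (h : ∀ r, r + v ∈ B → |r + v| ≤ |r| + b * c) :
    laplace b {r | r + v ∈ B} ≤ ENNReal.ofReal (Real.exp c) * laplace b B := by
  have hA : MeasurableSet {r | r + v ∈ B} := measurableSet_preimage (measurable_add_const v) hB
  have hm : Measurable fun r : ℝ => ENNReal.ofReal (Real.exp (-|r| / b) / (2 * b)) := by fun_prop
  unfold laplace
  rw [withDensity_apply _ hA, withDensity_apply _ hB, ← lintegral_indicator hA,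
    ← lintegral_indicator hB, ← lintegral_add_right_eq_self (B.indicator _) v,
    ← lintegral_const_mul _ (by have := hm.indicator hB; fun_prop)]
  refine lintegral_mono fun r => ?_
  by_cases hr : r + v ∈ B
  · rw [Set.indicator_of_mem (show r ∈ {r | r + v ∈ B} from hr), Set.indicator_of_mem hr,
      ← ENNReal.ofReal_mul (Real.exp_nonneg _), ← mul_div_assoc, ← Real.exp_add]
    refine ENNReal.ofReal_le_ofReal (div_le_div_of_nonneg_right (Real.exp_le_exp.2 ?_)
      (by positivity))
    have := h r hr
    rw [div_le_iff₀ hb, add_mul, div_mul_cancel₀ _ hb.ne']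
    linarith
  · rw [Set.indicator_of_notMem (show r ∉ {r | r + v ∈ B} from hr)]
    exact zero_le

theorem laplace_shift_le {ε v : ℝ} (hε : 0 < ε) (hv : |v| ≤ 1) {B : Set ℝ}
    (hB : MeasurableSet B) :
    laplace (1 / ε) {r | r + v ∈ B} ≤ ENNReal.ofReal (Real.exp ε) * laplace (1 / ε) B := by
  refine laplace_preimage_add_le (one_div_pos.2 hε) hB fun r _ => ?_
  rw [one_div_mul_cancel hε.ne']
  exact (abs_add_le _ _).trans (by linarith)

theorem laplace_le_neg_le {ε s : ℝ} (hε : 0 < ε) (hs : 0 ≤ s) :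
    laplace (1 / ε) {r | r + s ≤ 0} ≤ ENNReal.ofReal (Real.exp (-(ε * s))) := by
  have := isProbabilityMeasure_laplace (one_div_pos.2 hε)
  have h := laplace_preimage_add_le (c := -(ε * s)) (v := s) (one_div_pos.2 hε)
    (measurableSet_Iic (a := (0 : ℝ))) fun r hr => by
      have hr' : r + s ≤ 0 := hr
      rw [abs_of_nonpos hr', abs_of_nonpos (by linarith)]
      field_simp
      linarith
  exact h.trans (mul_le_of_le_one_right zero_le prob_le_one)

/-! ### The Hamming distance -/

theorem dataDist_comm {m d : ℕ} (x y : DataSet m d) : dataDist x y = dataDist y x :=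
  hammingDist_comm x y

theorem dataDist_triangle {m d : ℕ} (x y z : DataSet m d) :
    dataDist x z ≤ dataDist x y + dataDist y z :=
  hammingDist_triangle x y z

open Classical in
theorem dataDist_comp_perm {m d : ℕ} (x y : DataSet m d) (σ : Equiv.Perm (Fin m)) :
    dataDist (x ∘ σ) (y ∘ σ) = dataDist x y := by
  unfold dataDist hammingDist
  refine Finset.card_equiv σ fun i => ?_
  simp

theorem IsProjection.dataDistToSet_eq {m d : ℕ} {S : Set (DataSet m d)}
    {proj : DataSet m d → DataSet m d} (h : IsProjection S proj) (hS : S.Nonempty)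
    (x : DataSet m d) : dataDistToSet x S = (dataDist x (proj x) : ℕ∞) := by
  refine le_antisymm (iInf₂_le _ (h hS x).1) (le_iInf₂ fun z hz => ?_)
  exact_mod_cast (h hS x).2 z hz

theorem IsProjection.dataDist_le {m d : ℕ} {S : Set (DataSet m d)}
    {proj : DataSet m d → DataSet m d} (h : IsProjection S proj) (hS : S.Nonempty)
    (x y : DataSet m d) : dataDist x (proj x) ≤ dataDist x y + dataDist y (proj y) :=
  ((h hS x).2 _ (h hS y).1).trans (dataDist_triangle _ _ _)

/-! ### Indistinguishability -/

theorem indistinguishable_of_one_le {W : Type*} [MeasurableSpace W] {ε δ : ℝ} (hδ : 1 ≤ δ)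
    (P Q : Measure W) [IsProbabilityMeasure P] [IsProbabilityMeasure Q] :
    Indistinguishable ε δ P Q := fun E _ => by
  have h : (1 : ℝ≥0∞) ≤ ENNReal.ofReal δ := ENNReal.one_le_ofReal.2 hδ
  exact ⟨(prob_le_one.trans h).trans le_add_self, (prob_le_one.trans h).trans le_add_self⟩

theorem indistinguishable_self {W : Type*} [MeasurableSpace W] {ε δ : ℝ} (hε : 0 ≤ ε)
    (P : Measure W) : Indistinguishable ε δ P P := fun E _ => by
  have h : (1 : ℝ≥0∞) ≤ ENNReal.ofReal (Real.exp ε) :=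
    ENNReal.one_le_ofReal.2 (Real.one_le_exp hε)
  have h2 : P E ≤ ENNReal.ofReal (Real.exp ε) * P E + ENNReal.ofReal δ :=
    (le_mul_of_one_le_left zero_le h).trans le_self_add
  exact ⟨h2, h2⟩

/-- A one-sided privacy bound is preserved by uniform mixtures. -/
theorem uniform_mixture_le {ι W : Type*} [Fintype ι] [Nonempty ι] [MeasurableSpace W] {a b : ℝ≥0∞}
    (P Q : ι → Measure W) (E : Set W) (h : ∀ i, P i E ≤ a * Q i E + b) :
    (∑ i, (Fintype.card ι : ℝ≥0∞)⁻¹ • P i) E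
      ≤ a * (∑ i, (Fintype.card ι : ℝ≥0∞)⁻¹ • Q i) E + b := by
  simp only [Measure.coe_finsetSum, Finset.sum_apply, Measure.smul_apply, smul_eq_mul]
  have hc : ∑ _i : ι, (Fintype.card ι : ℝ≥0∞)⁻¹ * b = b := by
    rw [Finset.sum_const, Finset.card_univ, nsmul_eq_mul, ← mul_assoc,
      ENNReal.mul_inv_cancel (by simp [Fintype.card_ne_zero]) (ENNReal.natCast_ne_top _), one_mul]
  calc ∑ i, (Fintype.card ι : ℝ≥0∞)⁻¹ * P i E
      ≤ ∑ i, (a * ((Fintype.card ι : ℝ≥0∞)⁻¹ * Q i E) + (Fintype.card ι : ℝ≥0∞)⁻¹ * b) :=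
        Finset.sum_le_sum fun i _ => by
          calc _ ≤ (Fintype.card ι : ℝ≥0∞)⁻¹ * (a * Q i E + b) := by gcongr; exact h i
            _ = _ := by ring
    _ = _ := by rw [Finset.sum_add_distrib, hc, Finset.mul_sum]

/-! ### The mechanism after the permutation -/

/-- The Gaussian distribution released when the projected data set is `z`. -/
noncomputable def releaseGaussian {n d : ℕ} (Csq : ℝ) (z : DataSet (3 * n) d) :
    Measure (EuclideanSpace ℝ (Fin d)) :=
  multivariateGaussian (empMean z) (Csq • empCov z)

instance {n d : ℕ} (Csq : ℝ) (z : DataSet (3 * n) d) :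
    IsProbabilityMeasure (releaseGaussian Csq z) := by
  unfold releaseGaussian
  infer_instance

theorem afterPermutation_of_goodSet_empty {n d : ℕ} {ε : ℝ} (hε : 0 < ε) (t lam Csq : ℝ)
    (hS : goodSet n d lam = ∅) (proj : DataSet (3 * n) d → DataSet (3 * n) d)
    (x : DataSet (3 * n) d) :
    afterPermutation ε t lam Csq proj x = Measure.dirac outFail := by
  have := isProbabilityMeasure_laplace (one_div_pos.2 hε)
  have h : dataDistToSet x (goodSet n d lam) = ⊤ := by simp [dataDistToSet, hS]
  unfold afterPermutation
  simp only [h, true_or, if_true]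
  rw [Measure.bind_const, measure_univ, one_smul]

theorem afterPermutation_apply {n d : ℕ} (ε t lam Csq : ℝ)
    {proj : DataSet (3 * n) d → DataSet (3 * n) d} (hp : IsProjection (goodSet n d lam) proj)
    (hS : (goodSet n d lam).Nonempty) (x : DataSet (3 * n) d) {E : Set (Output d)}
    (hE : MeasurableSet E) :
    afterPermutation ε t lam Csq proj x E
      = laplace (1 / ε) {r | t < dataDist x (proj x) + r} * Measure.dirac outFail E
        + laplace (1 / ε) {r | dataDist x (proj x) + r ≤ t}
          * releaseGaussian Csq (proj x) (Sum.inl ⁻¹' E) := by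
  classical
  have hset : MeasurableSet {r : ℝ | t < dataDist x (proj x) + r} :=
    measurableSet_lt measurable_const (measurable_const.add measurable_id)
  have hcompl : {r : ℝ | t < dataDist x (proj x) + r}ᶜ = {r | dataDist x (proj x) + r ≤ t} := by
    ext r
    simp
  unfold afterPermutation
  rw [hp.dataDistToSet_eq hS]
  simp only [ENat.natCast_ne_top, false_or, ENat.toNat_natCast, gt_iff_lt]
  rw [Measure.bind_apply hE
    (Measurable.ite hset measurable_const measurable_const).aemeasurable,
    ← lintegral_add_compl _ hset, hcompl]
  congr 1
  · rw [setLIntegral_congr_fun (g := fun _ => Measure.dirac outFail E) hset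
      (fun r hr => by
        simp only [Set.mem_ofPred_eq] at hr
        simp only [if_pos hr]), setLIntegral_const, mul_comm]
  · rw [setLIntegral_congr_fun (g := fun _ => releaseGaussian Csq (proj x) (Sum.inl ⁻¹' E))
      (hcompl ▸ hset.compl) (fun r hr => by
        simp only [Set.mem_ofPred_eq] at hr
        rw [if_neg (not_lt.2 hr), Measure.map_apply measurable_inl hE]
        rfl), setLIntegral_const, mul_comm]

/-- Basic composition of the test with the release, for close projections: `q` and `p` are the
probabilities of failing and passing the test, `F` and `G` the conditional probabilities of the
event. -/
theorem mul_add_mul_le_of_le {q₁ q₂ p₁ p₂ F G₁ G₂ : ℝ≥0∞} {ε δ : ℝ} (hε : 0 ≤ ε)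
    (hq : q₁ ≤ ENNReal.ofReal (Real.exp ε) * q₂) (hp : p₁ ≤ ENNReal.ofReal (Real.exp ε) * p₂)
    (hp₂ : p₂ ≤ 1)
    (hG : G₁ ≤ ENNReal.ofReal (Real.exp (2 * ε)) * G₂ + ENNReal.ofReal ((1 + Real.exp ε) * δ)) :
    q₁ * F + p₁ * G₁ ≤ ENNReal.ofReal (Real.exp (3 * ε)) * (q₂ * F + p₂ * G₂)
      + ENNReal.ofReal (Real.exp ε * (1 + Real.exp ε) * δ) := by
  have h3 : ENNReal.ofReal (Real.exp (3 * ε))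
      = ENNReal.ofReal (Real.exp ε) * ENNReal.ofReal (Real.exp (2 * ε)) := by
    rw [← ENNReal.ofReal_mul (Real.exp_nonneg _), ← Real.exp_add]
    congr 2
    ring
  have h2 : (1 : ℝ≥0∞) ≤ ENNReal.ofReal (Real.exp (2 * ε)) :=
    ENNReal.one_le_ofReal.2 (Real.one_le_exp (by linarith))
  rw [mul_assoc, ENNReal.ofReal_mul (Real.exp_nonneg _), h3]
  set a := ENNReal.ofReal (Real.exp ε)
  set b := ENNReal.ofReal (Real.exp (2 * ε))
  set D := ENNReal.ofReal ((1 + Real.exp ε) * δ)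
  calc q₁ * F + p₁ * G₁ ≤ (a * q₂) * F + (a * p₂) * (b * G₂ + D) := by gcongr
    _ = a * 1 * (q₂ * F) + a * b * (p₂ * G₂) + p₂ * (a * D) := by ring
    _ ≤ a * b * (q₂ * F) + a * b * (p₂ * G₂) + 1 * (a * D) := by gcongr
    _ = _ := by ring

/-- The case of a data set far from good: passing is so unlikely that it is absorbed in the additive
term, and nothing is needed of the released distributions. -/
theorem mul_add_mul_le_of_small {q₁ q₂ p₁ p₂ F G₁ G₂ : ℝ≥0∞} {ε δ : ℝ} (hε : 0 ≤ ε) (hδ : 0 ≤ δ)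
    (hq : q₁ ≤ ENNReal.ofReal (Real.exp ε) * q₂) (hp : p₁ ≤ ENNReal.ofReal (Real.exp ε * δ))
    (hG : G₁ ≤ 1) :
    q₁ * F + p₁ * G₁ ≤ ENNReal.ofReal (Real.exp (3 * ε)) * (q₂ * F + p₂ * G₂)
      + ENNReal.ofReal (Real.exp ε * (1 + Real.exp ε) * δ) := by
  have h1 : ENNReal.ofReal (Real.exp ε) ≤ ENNReal.ofReal (Real.exp (3 * ε)) :=
    ENNReal.ofReal_le_ofReal (Real.exp_le_exp.2 (by linarith))
  have h2 : Real.exp ε * δ ≤ Real.exp ε * (1 + Real.exp ε) * δ := by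
    have : 0 ≤ Real.exp ε * Real.exp ε * δ := by positivity
    linarith
  calc q₁ * F + p₁ * G₁
      ≤ (ENNReal.ofReal (Real.exp (3 * ε)) * q₂) * F
        + ENNReal.ofReal (Real.exp ε * (1 + Real.exp ε) * δ) * 1 := by
        gcongr
        · exact hq.trans (by gcongr)
        · exact hp.trans (ENNReal.ofReal_le_ofReal h2)
    _ ≤ _ := by
        rw [mul_one, mul_assoc]
        gcongr
        exact le_self_add

theorem afterPermutation_le {n d : ℕ} {ε δ β lam Csq : ℝ} (hε : 0 < ε) (hδ : 0 < δ) (hδ1 : δ < 1)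
    (hβ : 0 < β) {proj : DataSet (3 * n) d → DataSet (3 * n) d}
    (hp : IsProjection (goodSet n d lam) proj)
    (hG : ∀ z ∈ goodSet n d lam, ∀ w ∈ goodSet n d lam, (dataDist z w : ℝ) ≤ kParam ε δ β →
      ∀ E, MeasurableSet E → releaseGaussian Csq z E
        ≤ ENNReal.ofReal (Real.exp (2 * ε)) * releaseGaussian Csq w E
          + ENNReal.ofReal ((1 + Real.exp ε) * δ))
    {x y : DataSet (3 * n) d} (hxy : dataDist x y ≤ 1) {E : Set (Output d)}
    (hE : MeasurableSet E) :
    afterPermutation ε (tParam ε β) lam Csq proj x E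
      ≤ ENNReal.ofReal (Real.exp (3 * ε)) * afterPermutation ε (tParam ε β) lam Csq proj y E
        + ENNReal.ofReal (Real.exp ε * (1 + Real.exp ε) * δ) := by
  have := isProbabilityMeasure_laplace (one_div_pos.2 hε)
  rcases (goodSet n d lam).eq_empty_or_nonempty with hS | hS
  · rw [afterPermutation_of_goodSet_empty hε _ _ _ hS, afterPermutation_of_goodSet_empty hε _ _ _ hS]
    exact (indistinguishable_self (by linarith) _ E hE).1
  rw [afterPermutation_apply _ _ _ _ hp hS x hE, afterPermutation_apply _ _ _ _ hp hS y hE]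
  set t := tParam ε β with ht
  set hx := dataDist x (proj x) with hhx
  set hy := dataDist y (proj y) with hhy
  have hle1 : hx ≤ hy + 1 := (hp.dataDist_le hS x y).trans (by omega)
  have hle2 : hy ≤ hx + 1 := (hp.dataDist_le hS y x).trans (by rw [dataDist_comm y x]; omega)
  have hv : |(hx : ℝ) - hy| ≤ 1 := by
    have h1 : (hx : ℝ) ≤ hy + 1 := by exact_mod_cast hle1
    have h2 : (hy : ℝ) ≤ hx + 1 := by exact_mod_cast hle2
    rw [abs_le]
    constructor <;> linarith
  have hq : laplace (1 / ε) {r | t < hx + r}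
      ≤ ENNReal.ofReal (Real.exp ε) * laplace (1 / ε) {r | t < hy + r} := by
    convert laplace_shift_le hε hv (B := {r | t < hy + r})
      (measurableSet_lt measurable_const (measurable_const.add measurable_id)) using 3
    ext r
    simp only [Set.mem_ofPred_eq]
    constructor <;> intro h <;> linarith
  have hpass : laplace (1 / ε) {r | hx + r ≤ t}
      ≤ ENNReal.ofReal (Real.exp ε) * laplace (1 / ε) {r | hy + r ≤ t} := by
    convert laplace_shift_le hε hv (B := {r | hy + r ≤ t})
      (measurableSet_le (measurable_const.add measurable_id) measurable_const) using 3
    ext r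
    simp only [Set.mem_ofPred_eq]
    constructor <;> intro h <;> linarith
  -- Chosen so that `exp (-(ε * s)) = δ`: a data set at distance more than `t + s` passes with
  -- probability at most `δ`. The parameter `k` is then `2 * (t + s) + 1`, the extra one being the
  -- step from `x` to `y`.
  set s := 1 / ε * Real.log (1 / δ) with hs
  have hs0 : 0 ≤ s := by
    have : 0 ≤ Real.log (1 / δ) := Real.log_nonneg (by rw [le_div_iff₀ hδ]; linarith)
    positivity
  have hk : kParam ε δ β = 2 * (t + s) + 1 := by
    rw [kParam, ht, hs, tParam, one_div (δ * β), mul_inv,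
      Real.log_mul (inv_ne_zero hδ.ne') (inv_ne_zero hβ.ne')]
    simp only [one_div]
    ring
  have htail : ∀ h : ℕ, t + s < h → laplace (1 / ε) {r | h + r ≤ t} ≤ ENNReal.ofReal δ := by
    intro h hh
    refine (measure_mono fun r hr => ?_).trans ((laplace_le_neg_le hε hs0).trans_eq ?_)
    · simp only [Set.mem_ofPred_eq] at hr ⊢
      linarith
    · rw [hs, ← mul_assoc, mul_one_div_cancel hε.ne', one_mul, one_div, Real.log_inv, neg_neg,
        Real.exp_log hδ]
  by_cases hclose : (hx : ℝ) ≤ t + s ∧ (hy : ℝ) ≤ t + s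
  · refine mul_add_mul_le_of_le hε.le hq hpass prob_le_one
      (hG _ (hp hS x).1 _ (hp hS y).1 ?_ _ (measurable_inl hE))
    have h1 : dataDist (proj x) (proj y) ≤ hx + (1 + hy) := by
      refine (dataDist_triangle _ x _).trans (add_le_add (dataDist_comm _ _).le ?_)
      exact (dataDist_triangle _ y _).trans (by omega)
    have h2 : (dataDist (proj x) (proj y) : ℝ) ≤ hx + (1 + hy) := by exact_mod_cast h1
    rw [hk]
    linarith
  · refine mul_add_mul_le_of_small hε.le hδ.le hq ?_ prob_le_one
    by_cases hx' : (hx : ℝ) ≤ t + s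
    -- Here only `y` is known to be far; its tail bound transfers to `x` at the price of a factor
    -- `e^ε`.
    · have hy' : t + s < hy := not_le.1 fun h => hclose ⟨hx', h⟩
      refine hpass.trans ?_
      rw [ENNReal.ofReal_mul (Real.exp_nonneg _)]
      gcongr
      exact htail _ hy'
    · refine (htail _ (not_le.1 hx')).trans (ENNReal.ofReal_le_ofReal ?_)
      exact le_mul_of_one_le_left hδ.le (Real.one_le_exp hε.le)

/-! ### The permutation -/

theorem rescaledGaussian_comp_perm (K c : ℝ) {n d : ℕ} (ε δ β : ℝ)
    (proj : DataSet (3 * n) d → DataSet (3 * n) d) (x : DataSet (3 * n) d)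
    (π : Equiv.Perm (Fin (3 * n))) :
    rescaledGaussian K c ε δ β proj (x ∘ π) = rescaledGaussian K c ε δ β proj x := by
  unfold rescaledGaussian
  dsimp only
  congr 1
  -- Left multiplication by `π` permutes the summands of the uniform mixture.
  refine Fintype.sum_equiv (Equiv.mulLeft π) _ _ fun σ => ?_
  rfl

theorem isDifferentiallyPrivate_multiset_of_neighboring {K c : ℝ} {n d : ℕ} {ε δ β η ν : ℝ}
    {proj : DataSet (3 * n) d → DataSet (3 * n) d}
    (h : IsDifferentiallyPrivate Neighboring η ν (rescaledGaussian K c ε δ β proj)) :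
    IsDifferentiallyPrivate MultisetNeighboring η ν (rescaledGaussian K c ε δ β proj) := by
  rintro x y ⟨π, hπ⟩
  rw [← rescaledGaussian_comp_perm K c ε δ β proj y π]
  exact h x _ hπ

theorem isDifferentiallyPrivate_rescaledGaussian_of_releaseGaussian {K c : ℝ} {n d : ℕ}
    {ε δ β : ℝ} (hε : 0 < ε) (hδ : 0 < δ) (hδ1 : δ < 1) (hβ : 0 < β)
    {proj : DataSet (3 * n) d → DataSet (3 * n) d}
    (hp : IsProjection (goodSet n d (lamParam c n d β)) proj)
    (hG : Real.exp ε * (1 + Real.exp ε) * δ < 1 →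
      K * (kParam ε δ β * lamParam c n d β / ε * Real.log (1 / δ)) ≤ n →
      ∀ z ∈ goodSet n d (lamParam c n d β), ∀ w ∈ goodSet n d (lamParam c n d β),
      (dataDist z w : ℝ) ≤ kParam ε δ β → ∀ E, MeasurableSet E →
      releaseGaussian (noiseScaleSq n ε δ (lamParam c n d β) (kParam ε δ β)) z E
        ≤ ENNReal.ofReal (Real.exp (2 * ε))
            * releaseGaussian (noiseScaleSq n ε δ (lamParam c n d β) (kParam ε δ β)) w E
          + ENNReal.ofReal ((1 + Real.exp ε) * δ)) :
    IsDifferentiallyPrivate Neighboring (3 * ε) (Real.exp ε * (1 + Real.exp ε) * δ)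
      (rescaledGaussian K c ε δ β proj) := by
  intro x y hxy
  -- If the additive error is at least 1 the claim is trivial; the other case yields the bound
  -- `e^{2ε} δ < 1` needed for the Gaussians.
  rcases le_or_gt 1 (Real.exp ε * (1 + Real.exp ε) * δ) with h1 | h1
  · have := isProbabilityMeasure_rescaledGaussian K c hε δ β proj x
    have := isProbabilityMeasure_rescaledGaussian K c hε δ β proj y
    exact indistinguishable_of_one_le h1 _ _
  unfold rescaledGaussian
  dsimp only
  split_ifs with hn
  · exact indistinguishable_self (by linarith) _
  · intro E hE
    have hG' := hG h1 (not_lt.1 hn)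
    refine ⟨uniform_mixture_le _ _ E fun σ => ?_, uniform_mixture_le _ _ E fun σ => ?_⟩
    · exact afterPermutation_le hε hδ hδ1 hβ hp hG' ((dataDist_comp_perm x y σ).trans_le hxy) hE
    · exact afterPermutation_le hε hδ hδ1 hβ hp hG'
        ((dataDist_comp_perm y x σ).trans_le (dataDist_comm y x ▸ hxy)) hE

/-! ### Simultaneous diagonalization -/

open scoped MatrixOrder in
-- Diagonalize `R⁻¹ T R⁻¹ = U D Uᵀ` with `R = √S` and `U` orthogonal; then `A = R U` and `B = Uᵀ
-- R⁻¹` work. Multiplication by `B` passes to whitened coordinates.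
theorem exists_simultaneous_diagonalization {d : ℕ} {S T : Matrix (Fin d) (Fin d) ℝ}
    (hS : S.PosDef) (hT : T.PosDef) :
    ∃ (A B : Matrix (Fin d) (Fin d) ℝ) (D : Fin d → ℝ), B * A = 1 ∧ (∀ i, 0 < D i) ∧
      A * A.transpose = S ∧ A * Matrix.diagonal D * A.transpose = T := by
  set R := CFC.sqrt S with hR
  have hRR : R * R = S := CFC.sqrt_mul_sqrt_self S hS.posSemidef.nonneg
  have hRt : R.transpose = R := by
    simpa using (Matrix.nonneg_iff_posSemidef.1 (CFC.sqrt_nonneg S)).isHermitian.eq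
  have hRu : IsUnit R := isUnit_of_mul_isUnit_left (hRR ▸ hS.isUnit)
  have hRd : IsUnit R.det := (Matrix.isUnit_iff_isUnit_det _).1 hRu
  have h1 : R * R⁻¹ = 1 := Matrix.mul_nonsing_inv _ hRd
  have h2 : R⁻¹ * R = 1 := Matrix.nonsing_inv_mul _ hRd
  have hRit : (R⁻¹).transpose = R⁻¹ := by rw [Matrix.transpose_nonsing_inv, hRt]
  have hW : (R⁻¹ * T * R⁻¹).PosDef := by
    have hpsd : (R⁻¹ * T * R⁻¹).PosSemidef := by
      have := hT.posSemidef.mul_mul_conjTranspose_same R⁻¹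
      rwa [Matrix.conjTranspose_eq_transpose_of_trivial, hRit] at this
    have hu : IsUnit R⁻¹ := IsUnit.of_mul_eq_one R h2
    exact hpsd.posDef_iff_isUnit.2 ((hu.mul hT.isUnit).mul hu)
  set U : Matrix (Fin d) (Fin d) ℝ := hW.isHermitian.eigenvectorUnitary.1 with hU
  have hU1 : U * U.transpose = 1 := by
    simpa [Matrix.star_eq_conjTranspose] using
      Unitary.coe_mul_star_self hW.isHermitian.eigenvectorUnitary
  have hU2 : U.transpose * U = 1 := mul_eq_one_comm.1 hU1
  have hspec : U * Matrix.diagonal hW.isHermitian.eigenvalues * U.transpose = R⁻¹ * T * R⁻¹ := by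
    have := hW.isHermitian.spectral_theorem
    rw [Unitary.conjStarAlgAut_apply] at this
    simpa [Matrix.star_eq_conjTranspose] using this.symm
  refine ⟨R * U, U.transpose * R⁻¹, hW.isHermitian.eigenvalues, ?_, hW.eigenvalues_pos, ?_, ?_⟩
  · rw [Matrix.mul_assoc, ← Matrix.mul_assoc R⁻¹, h2, Matrix.one_mul, hU2]
  · rw [Matrix.transpose_mul, hRt, Matrix.mul_assoc, ← Matrix.mul_assoc U, hU1, Matrix.one_mul, hRR]
  · calc R * U * Matrix.diagonal hW.isHermitian.eigenvalues * (R * U).transpose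
        = R * (U * Matrix.diagonal hW.isHermitian.eigenvalues * U.transpose) * R := by
          rw [Matrix.transpose_mul, hRt]; simp only [Matrix.mul_assoc]
      _ = (R * R⁻¹) * T * (R⁻¹ * R) := by rw [hspec]; simp only [Matrix.mul_assoc]
      _ = T := by rw [h1, h2, Matrix.one_mul, Matrix.mul_one]

theorem empCov_posSemidef {n d : ℕ} (x : DataSet (3 * n) d) : (empCov x).PosSemidef := by
  unfold empCov
  refine Matrix.PosSemidef.smul (Matrix.posSemidef_sum _ fun i _ => ?_) (by positivity)
  simpa using Matrix.posSemidef_vecMulVec_self_star (pairDiff x i).ofLp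

theorem empCov_posDef {n d : ℕ} {x : DataSet (3 * n) d} (h : IsUnit (empCov x)) :
    (empCov x).PosDef :=
  (empCov_posSemidef x).posDef_iff_isUnit.2 h

theorem mahalanobisSq_eq_sum {d : ℕ} {A B S : Matrix (Fin d) (Fin d) ℝ} {D : Fin d → ℝ}
    (hBA : B * A = 1) (hD : ∀ i, 0 < D i) (hS : A * Matrix.diagonal D * A.transpose = S)
    (v : EuclideanSpace ℝ (Fin d)) :
    mahalanobisSq S v = ∑ i, (B.mulVec v.ofLp) i ^ 2 / D i := by
  have hAB : A * B = 1 := mul_eq_one_comm.1 hBA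
  have hBA' : A.transpose * B.transpose = 1 := by
    rw [← Matrix.transpose_mul, hBA, Matrix.transpose_one]
  have hDD : Matrix.diagonal D * Matrix.diagonal (fun i => 1 / D i) = 1 := by
    rw [Matrix.diagonal_mul_diagonal, ← Matrix.diagonal_one]
    congr 1
    ext i
    exact mul_one_div_cancel (hD i).ne'
  have hinv : S⁻¹ = B.transpose * (Matrix.diagonal (fun i => 1 / D i) * B) := by
    refine Matrix.inv_eq_right_inv ?_
    calc S * (B.transpose * (Matrix.diagonal (fun i => 1 / D i) * B))
        = A * (Matrix.diagonal D * ((A.transpose * B.transpose)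
            * (Matrix.diagonal (fun i => 1 / D i) * B))) := by
          rw [← hS]; simp only [Matrix.mul_assoc]
      _ = A * ((Matrix.diagonal D * Matrix.diagonal (fun i => 1 / D i)) * B) := by
          rw [hBA', Matrix.one_mul, Matrix.mul_assoc]
      _ = 1 := by rw [hDD, Matrix.one_mul, hAB]
  rw [mahalanobisSq, hinv, ← Matrix.mulVec_mulVec, ← Matrix.mulVec_mulVec, Matrix.dotProduct_mulVec,
    ← Matrix.mulVec_transpose, Matrix.transpose_transpose]
  simp only [dotProduct, Matrix.mulVec_diagonal]
  exact Finset.sum_congr rfl fun i _ => by ring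

theorem sum_sq_pairDiff_eq {n d : ℕ} {x : DataSet (3 * n) d} {A B : Matrix (Fin d) (Fin d) ℝ}
    {D : Fin d → ℝ} (hBA : B * A = 1) (hS : A * Matrix.diagonal D * A.transpose = empCov x)
    (i : Fin d) :
    1 / (2 * (n : ℝ)) * ∑ j, (B.mulVec (pairDiff x j).ofLp) i ^ 2 = D i := by
  have hBA' : A.transpose * B.transpose = 1 := by
    rw [← Matrix.transpose_mul, hBA, Matrix.transpose_one]
  have h : B * empCov x * B.transpose = Matrix.diagonal D := by
    rw [← hS]
    calc B * (A * Matrix.diagonal D * A.transpose) * B.transpose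
        = (B * A) * Matrix.diagonal D * (A.transpose * B.transpose) := by
          simp only [Matrix.mul_assoc]
      _ = _ := by rw [hBA, hBA', Matrix.one_mul, Matrix.mul_one]
  have h2 := congrFun (congrFun h i) i
  rw [Matrix.diagonal_apply_eq] at h2
  rw [← h2, empCov]
  simp only [Matrix.mul_smul, Matrix.smul_mul, Matrix.smul_apply, smul_eq_mul, Matrix.mul_sum,
    Matrix.sum_mul, Matrix.sum_apply, Matrix.mul_vecMulVec, Matrix.vecMulVec_mul,
    Matrix.vecMulVec_apply, Matrix.vecMul_transpose, sq]

/-! ### Gaussian measures with close means and covariances -/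

theorem multivariateGaussian_le {d : ℕ} (μ₁ μ₂ : EuclideanSpace ℝ (Fin d))
    {A B : Matrix (Fin d) (Fin d) ℝ} {D : Fin d → ℝ} (hBA : B * A = 1) (hD : ∀ i, 0 < D i)
    {Csq α ε δ : ℝ} (hC : 0 < Csq) (hα : 1 ≤ α) (hδ : 0 < δ)
    (hmean : (α + α ^ 2) / 2 * ((∑ i, (B.mulVec (μ₁ - μ₂).ofLp) i ^ 2) / Csq)
      ≤ α * ε - Real.log (1 / δ))
    (hsmall : α * ∑ i, |1 - 1 / D i| ≤ 1 / 2)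
    (hcov : 2 * (α * ∑ i, |1 - 1 / D i|) ^ 2 ≤ α * ε - Real.log (1 / δ))
    {E : Set (EuclideanSpace ℝ (Fin d))} (hE : MeasurableSet E) :
    multivariateGaussian μ₁ (Csq • (A * A.transpose)) E
      ≤ ENNReal.ofReal (Real.exp (2 * ε))
          * multivariateGaussian μ₂ (Csq • (A * Matrix.diagonal D * A.transpose)) E
        + ENNReal.ofReal ((1 + Real.exp ε) * δ) := by
  have hAB : A * B = 1 := mul_eq_one_comm.1 hBA
  set c := √Csq with hc
  have hc0 : 0 < c := Real.sqrt_pos.2 hC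
  have hc2 : c * c = Csq := Real.mul_self_sqrt hC.le
  have hexp : Real.exp (α * ε - Real.log (1 / δ)) = Real.exp (α * ε) * δ := by
    rw [Real.exp_sub, Real.exp_log (one_div_pos.2 hδ), one_div, div_inv_eq_mul]
  set m : Fin d → ℝ := c⁻¹ • B.mulVec (μ₁ - μ₂).ofLp with hm
  have hscale : ∀ v : Fin d → ℝ, (c • A) * Matrix.diagonal v * (c • A).transpose
      = Csq • (A * Matrix.diagonal v * A.transpose) := fun v => by
    rw [Matrix.transpose_smul, Matrix.smul_mul, Matrix.smul_mul, Matrix.mul_smul, smul_smul, hc2]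
  have e1 := map_affine_pi_gaussianReal μ₁ μ₂ (Csq • (A * A.transpose)) (c • A) m (fun _ => 1)
    (fun _ => zero_le_one) (by rw [hscale, Matrix.diagonal_one, Matrix.mul_one]) (by
      rw [hm, Matrix.smul_mulVec, Matrix.mulVec_smul, smul_smul, mul_inv_cancel₀ hc0.ne', one_smul,
        Matrix.mulVec_mulVec, hAB, Matrix.one_mulVec, WithLp.ofLp_sub]
      abel)
  have e2 := map_affine_pi_gaussianReal μ₂ μ₂ (Csq • (A * Matrix.diagonal D * A.transpose))
    (c • A) 0 D (fun i => (hD i).le) (hscale D) (by rw [Matrix.mulVec_zero, add_zero])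
  have hmeas : Measurable fun x : Fin d → ℝ => WithLp.toLp 2 (μ₂.ofLp + (c • A).mulVec x) := by
    fun_prop
  rw [← e1, ← e2, Measure.map_apply hmeas hE, Measure.map_apply hmeas hE]
  simp only [Real.toNNReal_one, Pi.zero_apply]
  have h1 := pi_gaussianReal_shift_le m (α := α) (ε := ε) (δ := δ) (by linarith) (by
    rw [← hexp]
    refine Real.exp_le_exp.2 (le_trans (le_of_eq ?_) hmean)
    congr 1
    simp only [hm, Pi.smul_apply, smul_eq_mul, mul_pow]
    rw [← Finset.mul_sum, inv_pow, sq c, hc2, inv_mul_eq_div]) _ (hmeas hE)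
  have h2 := pi_gaussianReal_scale_le D hD (α := α) (ε := ε) (δ := δ) hα hsmall (by
    rw [← hexp]
    exact Real.exp_le_exp.2 hcov) _ (hmeas hE)
  -- The intermediate law has mean `μ₂` and the first covariance. The second `δ` is multiplied by
  -- the `e^ε` of the first comparison.
  refine h1.trans ((add_le_add_left (mul_le_mul_right h2 _) _).trans (le_of_eq ?_))
  rw [mul_add, ← mul_assoc, ← ENNReal.ofReal_mul (Real.exp_nonneg _), ← Real.exp_add, ← two_mul,
    add_assoc, ← ENNReal.ofReal_mul (Real.exp_nonneg _), ← ENNReal.ofReal_add (by positivity) hδ.le]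
  congr 2
  ring

/-! ### Stability of the empirical covariance and mean -/

/-- Let `p i` and `q i` be the shares of the changed pairs in the two variances, each relative to
its own variance. The unchanged pairs contribute equally, so `D i * (1 - q i) = 1 - p i`. Goodness
bounds `∑ p i` and `∑ q i` by `k * 4 lam / (2n) = γ`. -/
theorem cov_ratio_bounds {n d : ℕ} (a b : Fin n → Fin d → ℝ) {D : Fin d → ℝ}
    (hD : ∀ i, 0 < D i) {k lam γ : ℝ} (hn : 0 < n) (hlam : 0 ≤ lam) (hγ : γ = 2 * k * lam / n)
    (hγ1 : γ ≤ 1 / 2) (T : Finset (Fin n)) (hT : ∀ j ∉ T, a j = b j) (hcard : (T.card : ℝ) ≤ k)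
    (ha1 : ∀ i, 1 / (2 * (n : ℝ)) * ∑ j, a j i ^ 2 = 1)
    (hb1 : ∀ i, 1 / (2 * (n : ℝ)) * ∑ j, b j i ^ 2 = D i)
    (ha : ∀ j, ∑ i, a j i ^ 2 ≤ 4 * lam) (hb : ∀ j, ∑ i, b j i ^ 2 / D i ≤ 4 * lam) :
    (∀ i, D i ≤ 1 / (1 - γ)) ∧ ∑ i, |1 - 1 / D i| ≤ 3 * γ := by
  have hn' : (0 : ℝ) < n := by exact_mod_cast hn
  set p : Fin d → ℝ := fun i => 1 / (2 * (n : ℝ)) * ∑ j ∈ T, a j i ^ 2 with hp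
  set q : Fin d → ℝ := fun i => 1 / (2 * (n : ℝ)) * ∑ j ∈ T, b j i ^ 2 / D i with hq
  have hp0 : ∀ i, 0 ≤ p i := fun i => by positivity
  have hq0 : ∀ i, 0 ≤ q i := fun i =>
    mul_nonneg (by positivity) (Finset.sum_nonneg fun j _ => div_nonneg (sq_nonneg _) (hD i).le)
  have hbound : ∀ f : Fin n → Fin d → ℝ, (∀ j, ∑ i, f j i ≤ 4 * lam) →
      ∑ i, 1 / (2 * (n : ℝ)) * ∑ j ∈ T, f j i ≤ γ := fun f hf => by
    rw [← Finset.mul_sum, Finset.sum_comm]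
    calc 1 / (2 * (n : ℝ)) * ∑ j ∈ T, ∑ i, f j i
        ≤ 1 / (2 * (n : ℝ)) * (k * (4 * lam)) := by
          gcongr
          refine (Finset.sum_le_card_nsmul _ _ _ fun j _ => hf j).trans ?_
          rw [nsmul_eq_mul]
          gcongr
      _ = γ := by rw [hγ]; field_simp; ring
  have hpsum : ∑ i, p i ≤ γ := hbound (fun j i => a j i ^ 2) ha
  have hqsum : ∑ i, q i ≤ γ := hbound (fun j i => b j i ^ 2 / D i) hb
  have hple : ∀ i, p i ≤ γ := fun i =>
    (Finset.single_le_sum (fun i _ => hp0 i) (Finset.mem_univ i)).trans hpsum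
  have hqle : ∀ i, q i ≤ γ := fun i =>
    (Finset.single_le_sum (fun i _ => hq0 i) (Finset.mem_univ i)).trans hqsum
  have hrel : ∀ i, D i * (1 - q i) = 1 - p i := fun i => by
    have hDi := (hD i).ne'
    have h1 : D i * q i = 1 / (2 * (n : ℝ)) * ∑ j ∈ T, b j i ^ 2 := by
      rw [hq]
      simp only [← Finset.sum_div]
      field_simp
    have h2 : ∑ j ∈ Tᶜ, a j i ^ 2 = ∑ j ∈ Tᶜ, b j i ^ 2 :=
      Finset.sum_congr rfl fun j hj => by rw [hT j (Finset.mem_compl.1 hj)]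
    have h3 := ha1 i
    have h4 := hb1 i
    rw [← Finset.sum_add_sum_compl T, mul_add] at h3 h4
    rw [h2] at h3
    rw [mul_sub, h1]
    simp only [hp]
    linarith
  refine ⟨fun i => ?_, ?_⟩
  · rw [le_div_iff₀ (by linarith)]
    have := mul_le_mul_of_nonneg_left (hqle i) (hD i).le
    nlinarith [hrel i, hp0 i]
  · have hi : ∀ i, |1 - 1 / D i| ≤ q i + 2 * p i := fun i => by
      have hDi := hD i
      -- Indeed `D i = 1 - p i + D i * q i ≥ 1 - γ`.
      have hDge : 1 / 2 ≤ D i := by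
        have := mul_nonneg hDi.le (hq0 i)
        linarith [hrel i, hple i]
      have h1 : 1 - 1 / D i = q i - p i / D i := by
        have := hrel i
        field_simp
        linarith
      have h2 : p i / D i ≤ 2 * p i := by
        rw [div_le_iff₀ hDi]
        nlinarith [hp0 i]
      have h3 : 0 ≤ p i / D i := div_nonneg (hp0 i) hDi.le
      rw [h1, abs_le]
      constructor <;> linarith [hq0 i, hp0 i]
    calc ∑ i, |1 - 1 / D i| ≤ ∑ i, (q i + 2 * p i) := Finset.sum_le_sum fun i _ => hi i
      _ = ∑ i, q i + 2 * ∑ i, p i := by rw [Finset.sum_add_distrib, Finset.mul_sum]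
      _ ≤ 3 * γ := by linarith

/-- Each changed point moves by at most `r + s + ‖m₁ - m₂‖`, as seen by passing through both means;
the last term is absorbed on the left, hence the factor `n - k`. -/
theorem mean_shift_bound {V : Type*} [NormedAddCommGroup V] [NormedSpace ℝ V] {n : ℕ}
    (hn : 0 < n) (p q : Fin n → V) {m₁ m₂ : V} (h₁ : m₁ = (1 / (n : ℝ)) • ∑ j, p j)
    (h₂ : m₂ = (1 / (n : ℝ)) • ∑ j, q j) {r s k : ℝ} (hp : ∀ j, ‖p j - m₁‖ ≤ r)
    (hq : ∀ j, ‖q j - m₂‖ ≤ s) (T : Finset (Fin n)) (hT : ∀ j ∉ T, p j = q j)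
    (hcard : (T.card : ℝ) ≤ k) :
    (n - k) * ‖m₁ - m₂‖ ≤ k * (r + s) := by
  have hn' : (0 : ℝ) < n := by exact_mod_cast hn
  have hr : 0 ≤ r := (norm_nonneg _).trans (hp ⟨0, hn⟩)
  have hs : 0 ≤ s := (norm_nonneg _).trans (hq ⟨0, hn⟩)
  have h2 : ∑ j ∈ Tᶜ, p j = ∑ j ∈ Tᶜ, q j :=
    Finset.sum_congr rfl fun j hj => hT j (Finset.mem_compl.1 hj)
  have h3 : (n : ℝ) • (m₁ - m₂) = ∑ j ∈ T, (p j - q j) := by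
    rw [h₁, h₂, ← smul_sub, smul_smul, mul_one_div_cancel hn'.ne', one_smul,
      ← Finset.sum_add_sum_compl T p, ← Finset.sum_add_sum_compl T q, h2, Finset.sum_sub_distrib]
    abel
  have h4 : (n : ℝ) * ‖m₁ - m₂‖ ≤ T.card * (r + s + ‖m₁ - m₂‖) := by
    calc (n : ℝ) * ‖m₁ - m₂‖ = ‖(n : ℝ) • (m₁ - m₂)‖ := by
          rw [norm_smul, Real.norm_of_nonneg hn'.le]
      _ ≤ ∑ j ∈ T, ‖p j - q j‖ := by rw [h3]; exact norm_sum_le _ _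
      _ ≤ ∑ _j ∈ T, (r + s + ‖m₁ - m₂‖) := Finset.sum_le_sum fun j _ => by
          have : p j - q j = (p j - m₁) - (q j - m₂) + (m₁ - m₂) := by abel
          rw [this]
          refine (norm_add_le _ _).trans (add_le_add_left ((norm_sub_le _ _).trans ?_) _)
          exact add_le_add (hp j) (hq j)
      _ = _ := by rw [Finset.sum_const, nsmul_eq_mul]
  have h5 : (T.card : ℝ) * (r + s + ‖m₁ - m₂‖) ≤ k * (r + s + ‖m₁ - m₂‖) := by gcongr
  linarith

open Classical in
theorem card_pairDiff_ne_le {n d : ℕ} (z w : DataSet (3 * n) d) :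
    (Finset.univ.filter fun j : Fin n => pairDiff z j ≠ pairDiff w j).card ≤ dataDist z w := by
  unfold dataDist hammingDist
  -- Send a changed pair to a changed record in it; different pairs share no record, so this is
  -- injective.
  let f : Fin n → Fin (3 * n) := fun j =>
    if z ⟨j, by omega⟩ ≠ w ⟨j, by omega⟩ then ⟨j, by omega⟩ else ⟨j + n, by omega⟩
  refine Finset.card_le_card_of_injOn f (fun j hj => ?_) (fun i _ j _ hij => ?_)
  · simp only [Finset.coe_filter, Finset.mem_univ, true_and, Set.mem_ofPred_eq] at hj ⊢
    by_cases h : z ⟨j, by omega⟩ ≠ w ⟨j, by omega⟩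
    · simpa only [f, if_pos h] using h
    · simp only [f, if_neg h]
      intro h'
      rw [not_not] at h
      exact hj (by rw [pairDiff, pairDiff, h, h'])
  · simp only [f] at hij
    ext
    split_ifs at hij <;> simp only [Fin.mk.injEq] at hij <;> omega

open Classical in
theorem card_last_third_ne_le {n d : ℕ} (z w : DataSet (3 * n) d) :
    (Finset.univ.filter fun j : Fin n =>
      z ⟨j + 2 * n, by omega⟩ ≠ w ⟨j + 2 * n, by omega⟩).card ≤ dataDist z w := by
  unfold dataDist hammingDist
  refine Finset.card_le_card_of_injOn (fun j : Fin n => (⟨j + 2 * n, by omega⟩ : Fin (3 * n)))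
    (fun j hj => ?_) (fun i _ j _ hij => ?_)
  · simpa using hj
  · simp only [Fin.mk.injEq] at hij
    ext
    omega

/-! ### Good data sets in whitened coordinates -/

theorem mulVec_pairDiff_sq_le {n d : ℕ} (B : Matrix (Fin d) (Fin d) ℝ) {D : Fin d → ℝ}
    (hD : ∀ i, 0 < D i) {x : DataSet (3 * n) d} {lam : ℝ}
    (hx : ∀ i, ∑ l, (B.mulVec (x i - empMean x).ofLp) l ^ 2 / D l ≤ lam) (j : Fin n) :
    ∑ l, (B.mulVec (pairDiff x j).ofLp) l ^ 2 / D l ≤ 4 * lam := by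
  set u := B.mulVec (x ⟨j, by omega⟩ - empMean x).ofLp with hu
  set v := B.mulVec (x ⟨j + n, by omega⟩ - empMean x).ofLp with hv
  have huv : B.mulVec (pairDiff x j).ofLp = u - v := by
    rw [hu, hv, ← Matrix.mulVec_sub, ← WithLp.ofLp_sub, sub_sub_sub_cancel_right, pairDiff]
  have h1 : ∀ l, (u - v) l ^ 2 / D l ≤ 2 * (u l ^ 2 / D l) + 2 * (v l ^ 2 / D l) := fun l => by
    rw [← mul_div_assoc, ← mul_div_assoc, ← add_div, Pi.sub_apply]
    refine div_le_div_of_nonneg_right ?_ (hD l).le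
    nlinarith [sq_nonneg (u l + v l)]
  rw [huv]
  calc ∑ l, (u - v) l ^ 2 / D l ≤ ∑ l, (2 * (u l ^ 2 / D l) + 2 * (v l ^ 2 / D l)) :=
        Finset.sum_le_sum fun l _ => h1 l
    _ = 2 * ∑ l, u l ^ 2 / D l + 2 * ∑ l, v l ^ 2 / D l := by
        rw [Finset.sum_add_distrib, Finset.mul_sum, Finset.mul_sum]
    _ ≤ 4 * lam := by
        have h2 := hx ⟨j, by omega⟩
        have h3 := hx ⟨j + n, by omega⟩
        linarith

/-- A good data set in positive dimension `d` forces `n > 0` and `2 lam ≥ 1`. -/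
theorem pos_and_one_le_of_mem_goodSet {n d : ℕ} (hd : 0 < d) {lam : ℝ} {z : DataSet (3 * n) d}
    (hzg : z ∈ goodSet n d lam) : 0 < n ∧ 1 ≤ 2 * lam := by
  obtain ⟨A, B, D, hBA, hD, -, hz⟩ :=
    exists_simultaneous_diagonalization (empCov_posDef hzg.1) (empCov_posDef hzg.1)
  have ha1 := sum_sq_pairDiff_eq hBA hz
  have hn : 0 < n := by
    rcases Nat.eq_zero_or_pos n with rfl | h
    · have h1 := ha1 ⟨0, hd⟩
      have h2 := hD ⟨0, hd⟩
      simp only [CharP.cast_eq_zero, mul_zero, div_zero, zero_mul] at h1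
      linarith
    · exact h
  have hn' : (0 : ℝ) < n := by exact_mod_cast hn
  have ha := mulVec_pairDiff_sq_le B hD
    (fun i => by rw [← mahalanobisSq_eq_sum hBA hD hz]; exact hzg.2 i : ∀ i,
      ∑ l, (B.mulVec (z i - empMean z).ofLp) l ^ 2 / D l ≤ lam)
  have h1 : ∀ i, 1 / (2 * (n : ℝ)) * ∑ j, (B.mulVec (pairDiff z j).ofLp) i ^ 2 / D i = 1 :=
    fun i => by rw [← Finset.sum_div, ← mul_div_assoc, ha1, div_self (hD i).ne']
  refine ⟨hn, le_trans (by exact_mod_cast hd) (?_ : (d : ℝ) ≤ 2 * lam)⟩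
  -- Take the trace of the whitened covariance: it is `d`, and also an average of squared norms of
  -- pair differences.
  calc (d : ℝ)
      = ∑ i, 1 / (2 * (n : ℝ)) * ∑ j, (B.mulVec (pairDiff z j).ofLp) i ^ 2 / D i := by
        rw [Finset.sum_congr rfl fun i _ => h1 i]
        simp
    _ = 1 / (2 * (n : ℝ)) * ∑ j, ∑ i, (B.mulVec (pairDiff z j).ofLp) i ^ 2 / D i := by
        rw [← Finset.mul_sum, Finset.sum_comm]
    _ ≤ 1 / (2 * (n : ℝ)) * (n * (4 * lam)) := by
        gcongr
        refine (Finset.sum_le_card_nsmul _ _ _ fun j _ => ha j).trans ?_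
        simp
    _ = 2 * lam := by field_simp; ring

theorem toLp_mulVec_empMean {n d : ℕ} (B : Matrix (Fin d) (Fin d) ℝ) (x : DataSet (3 * n) d) :
    (WithLp.toLp 2 (B.mulVec (empMean x).ofLp) : EuclideanSpace ℝ (Fin d))
      = (1 / (n : ℝ)) • ∑ j : Fin n, WithLp.toLp 2 (B.mulVec (x ⟨j + 2 * n, by omega⟩).ofLp) := by
  have h := (map_smul (Matrix.toEuclideanLin B) (1 / (n : ℝ))
    (∑ j : Fin n, x ⟨j + 2 * n, by omega⟩))
  rw [map_sum] at h
  exact h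

/-- The distance, in whitened coordinates, of good data sets that differ in at most `k` records. -/
theorem whitened_bounds {n d : ℕ} (hd : 0 < d) {lam k γ : ℝ} {z w : DataSet (3 * n) d}
    {A B : Matrix (Fin d) (Fin d) ℝ} {D : Fin d → ℝ} (hBA : B * A = 1) (hD : ∀ i, 0 < D i)
    (hz : A * A.transpose = empCov z) (hw : A * Matrix.diagonal D * A.transpose = empCov w)
    (hzg : z ∈ goodSet n d lam) (hwg : w ∈ goodSet n d lam) (hk : (dataDist z w : ℝ) ≤ k)
    (hγ : γ = 2 * k * lam / n) (hγ1 : γ ≤ 1 / 2) :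
    ∑ i, |1 - 1 / D i| ≤ 3 * γ ∧
      (n * (1 - γ)) ^ 2 * ∑ i, (B.mulVec (empMean z - empMean w).ofLp) i ^ 2
        ≤ 4 * k ^ 2 * (lam / (1 - γ)) := by
  classical
  obtain ⟨hn, hlam1⟩ := pos_and_one_le_of_mem_goodSet hd hzg
  have hz' : A * Matrix.diagonal (fun _ => 1) * A.transpose = empCov z := by
    rw [Matrix.diagonal_one, Matrix.mul_one, hz]
  have hn' : (0 : ℝ) < n := by exact_mod_cast hn
  have hzm : ∀ i, ∑ l, (B.mulVec (z i - empMean z).ofLp) l ^ 2 / (fun _ => (1 : ℝ)) l ≤ lam :=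
    fun i => by rw [← mahalanobisSq_eq_sum hBA (fun _ => one_pos) hz']; exact hzg.2 i
  have hwm : ∀ i, ∑ l, (B.mulVec (w i - empMean w).ofLp) l ^ 2 / D l ≤ lam :=
    fun i => by rw [← mahalanobisSq_eq_sum hBA hD hw]; exact hwg.2 i
  have ha := mulVec_pairDiff_sq_le B (fun _ => one_pos) hzm
  have hb := mulVec_pairDiff_sq_le B hD hwm
  simp only [div_one] at ha hzm
  have ha1 := sum_sq_pairDiff_eq hBA hz'
  have hb1 := sum_sq_pairDiff_eq hBA hw
  have hlam0 : 0 ≤ lam := by linarith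
  have hk0 : 0 ≤ k := (Nat.cast_nonneg _).trans hk
  have hcov := cov_ratio_bounds (fun j => B.mulVec (pairDiff z j).ofLp)
    (fun j => B.mulVec (pairDiff w j).ofLp) hD hn hlam0 hγ hγ1
    (Finset.univ.filter fun j => pairDiff z j ≠ pairDiff w j)
    (fun j hj => by
      have : pairDiff z j = pairDiff w j := by simpa using hj
      simp only [this])
    (le_trans (by exact_mod_cast card_pairDiff_ne_le z w) hk) ha1 hb1 ha hb
  refine ⟨hcov.2, ?_⟩
  have h1γ : 0 < 1 - γ := by linarith
  have hγ0 : 0 ≤ γ := by rw [hγ]; positivity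
  have hsub : ∀ u v : EuclideanSpace ℝ (Fin d),
      ‖(WithLp.toLp 2 (B.mulVec u.ofLp) : EuclideanSpace ℝ (Fin d)) - WithLp.toLp 2 (B.mulVec v.ofLp)‖
        = √(∑ i, (B.mulVec (u - v).ofLp) i ^ 2) := fun u v => by
    rw [← WithLp.toLp_sub, ← Matrix.mulVec_sub, ← WithLp.ofLp_sub, EuclideanSpace.norm_eq]
    simp
  -- A common squared radius for both data sets: measuring `w` in the norm of `Σ_z` instead of `Σ_w`
  -- costs the factor `D i ≤ 1 / (1 - γ)`.
  set X := lam / (1 - γ) with hX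
  have hX0 : 0 ≤ X := by positivity
  have hlamX : lam ≤ X := by
    rw [hX, le_div_iff₀ h1γ]
    nlinarith
  have hmean := mean_shift_bound hn
    (fun j : Fin n => (WithLp.toLp 2 (B.mulVec (z ⟨j + 2 * n, by omega⟩).ofLp) :
      EuclideanSpace ℝ (Fin d)))
    (fun j : Fin n => WithLp.toLp 2 (B.mulVec (w ⟨j + 2 * n, by omega⟩).ofLp))
    (toLp_mulVec_empMean B z) (toLp_mulVec_empMean B w) (r := √X) (s := √X) (k := k)
    (fun j => by
      rw [hsub]
      exact Real.sqrt_le_sqrt ((hzm _).trans hlamX))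
    (fun j => by
      rw [hsub]
      refine Real.sqrt_le_sqrt ?_
      calc ∑ i, (B.mulVec (w ⟨j + 2 * n, by omega⟩ - empMean w).ofLp) i ^ 2
          ≤ ∑ i, (1 / (1 - γ)) * ((B.mulVec (w ⟨j + 2 * n, by omega⟩ - empMean w).ofLp) i ^ 2 / D i) :=
            Finset.sum_le_sum fun i _ => by
              have h0 := hD i
              calc _ = D i * ((B.mulVec (w ⟨j + 2 * n, by omega⟩ - empMean w).ofLp) i ^ 2 / D i) := by
                    field_simp
                _ ≤ _ := mul_le_mul_of_nonneg_right (hcov.1 i) (by positivity)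
        _ ≤ (1 / (1 - γ)) * lam := by
            rw [← Finset.mul_sum]
            exact mul_le_mul_of_nonneg_left (hwm _) (by positivity)
        _ = X := by rw [hX]; ring)
    (Finset.univ.filter fun j => z ⟨j + 2 * n, by omega⟩ ≠ w ⟨j + 2 * n, by omega⟩)
    (fun j hj => by
      have : z ⟨j + 2 * n, by omega⟩ = w ⟨j + 2 * n, by omega⟩ := by simpa using hj
      simp only [this])
    (le_trans (by exact_mod_cast card_last_third_ne_le z w) hk)
  rw [hsub] at hmean
  set Y := ∑ i, (B.mulVec (empMean z - empMean w).ofLp) i ^ 2 with hY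
  have hY0 : 0 ≤ Y := Finset.sum_nonneg fun i _ => sq_nonneg _
  -- Since `γ * n = 2 * k * lam` and `2 * lam ≥ 1`. Thus `n - k` may be replaced by `n * (1 - γ)`.
  have hkn : k ≤ γ * n := by
    rw [hγ, div_mul_cancel₀ _ hn'.ne']
    nlinarith
  have h2 : n * (1 - γ) * √Y ≤ 2 * k * √X := by
    have : n * (1 - γ) * √Y ≤ (n - k) * √Y :=
      mul_le_mul_of_nonneg_right (by linarith) (Real.sqrt_nonneg _)
    linarith
  have h3 := pow_le_pow_left₀ (by positivity) h2 2
  rw [mul_pow _ (√Y), mul_pow _ (√X), Real.sq_sqrt hY0, Real.sq_sqrt hX0] at h3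
  linarith

/-! ### Closeness of the released Gaussian distributions -/

/-- The sample size test makes `γ = 2kλ/n` small. -/
theorem gamma_bounds {n K k lam ε L γ : ℝ} (hn : 0 < n) (hK : 100 ≤ K) (hk : 0 < k)
    (hlam : 0 < lam) (hε : 0 < ε) (hL : 2 * ε < L) (h : K * (k * lam / ε * L) ≤ n)
    (hγ : γ = 2 * k * lam / n) : γ * L ≤ ε / 50 ∧ γ ≤ 1 / 100 := by
  have hL0 : 0 < L := by linarith
  have hγ0 : 0 < γ := by rw [hγ]; positivity
  have h0 : 0 < k * lam / ε * L := by positivity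
  have h1 : 100 * (k * lam / ε * L) ≤ n := (mul_le_mul_of_nonneg_right hK h0.le).trans h
  have h2 : 100 * (k * lam / ε * L) * ε = 100 * (k * lam * L) := by field_simp
  have h3 := mul_le_mul_of_nonneg_right h1 hε.le
  have h4 : γ * L ≤ ε / 50 := by
    rw [hγ, div_mul_eq_mul_div, div_le_iff₀ hn]
    linarith
  refine ⟨h4, le_of_mul_le_mul_right (a := 2 * ε) ?_ (by positivity)⟩
  have h5 := mul_le_mul_of_nonneg_left hL.le hγ0.le
  linarith

/-- For this `α` the budget `α * ε - L` equals `L > 1 / 2`, while `α * T ≤ 6 γ L / ε ≤ 3 / 25`. -/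
theorem covariance_loss_bounds {ε L γ T α : ℝ} (hε : 0 < ε) (hL : 1 / 2 < L) (hα : α = 2 * L / ε)
    (hT0 : 0 ≤ T) (hγL : γ * L ≤ ε / 50) (hT : T ≤ 3 * γ) :
    α * T ≤ 1 / 2 ∧ 2 * (α * T) ^ 2 ≤ α * ε - L := by
  have hα0 : 0 ≤ α := by rw [hα]; positivity
  have hαε : α * ε = 2 * L := by rw [hα]; field_simp
  have hαT : α * T ≤ 3 / 25 := by
    have h1 : α * T ≤ α * (3 * γ) := mul_le_mul_of_nonneg_left hT hα0
    have h2 : α * (3 * γ) = 6 * (γ * L) / ε := by rw [hα]; field_simp; ring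
    have h3 : 6 * (γ * L) / ε ≤ 3 / 25 := by
      rw [div_le_iff₀ hε]
      linarith
    linarith
  have h4 : (α * T) ^ 2 ≤ (3 / 25) ^ 2 := pow_le_pow_left₀ (by positivity) hαT 2
  constructor <;> linarith

/-- The constant 32 in `Csq` exceeds the 4 in the mean bound by a factor 8, of which `γ ≤ 1 / 100`
leaves 7. The loss is then at most `4 L / 7`, within the budget `L`. -/
theorem mean_loss_bound {n k ε L l γ X Y Csq α : ℝ} (hn : 0 < n) (hε : 0 < ε) (hL : 0 < L)
    (hLl : L ≤ l) (hα : α = 2 * L / ε) (hα1 : 1 ≤ α) (hγ : γ ≤ 1 / 100) (hY0 : 0 ≤ Y)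
    (hC : Csq = 32 * k ^ 2 / (ε ^ 2 * n ^ 2) * X * l) (hC0 : 0 < Csq)
    (hY : (n * (1 - γ)) ^ 2 * Y ≤ 4 * k ^ 2 * X) :
    (α + α ^ 2) / 2 * (Y / Csq) ≤ α * ε - L := by
  have hαε : α * ε = 2 * L := by rw [hα]; field_simp
  have hYC : 7 * L * Y ≤ ε ^ 2 * Csq := by
    have h1 : 8 * l * (4 * k ^ 2 * X) = ε ^ 2 * n ^ 2 * Csq := by
      rw [hC]; field_simp; ring
    have h2 : 8 * l * ((n * (1 - γ)) ^ 2 * Y) ≤ ε ^ 2 * n ^ 2 * Csq := by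
      rw [← h1]
      exact mul_le_mul_of_nonneg_left hY (by linarith)
    have h3 : 7 ≤ 8 * (1 - γ) ^ 2 := by nlinarith
    have h4 : 7 * (L * Y) ≤ 8 * (1 - γ) ^ 2 * (l * Y) :=
      mul_le_mul h3 (mul_le_mul_of_nonneg_right hLl hY0) (by positivity) (by positivity)
    have h5 : n ^ 2 * (7 * L * Y) ≤ n ^ 2 * (ε ^ 2 * Csq) := by
      have := mul_le_mul_of_nonneg_left h4 (sq_nonneg n)
      linarith
    exact le_of_mul_le_mul_left h5 (by positivity)
  have h1 : Y / Csq ≤ ε ^ 2 / (7 * L) := by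
    rw [div_le_div_iff₀ hC0 (by positivity)]
    linarith
  have h2 : α ^ 2 * (ε ^ 2 / (7 * L)) = 4 * L / 7 := by
    rw [hα]; field_simp; ring
  have h3 : (α + α ^ 2) / 2 ≤ α ^ 2 := by nlinarith
  calc (α + α ^ 2) / 2 * (Y / Csq) ≤ α ^ 2 * (ε ^ 2 / (7 * L)) :=
        mul_le_mul h3 h1 (by positivity) (by positivity)
    _ ≤ α * ε - L := by rw [h2, hαε]; linarith

theorem releaseGaussian_le {n d : ℕ} {K ε δ lam k : ℝ} (hK : 100 ≤ K) (hε : 0 < ε) (hδ : 0 < δ)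
    (hsmall : Real.exp ε * (1 + Real.exp ε) * δ < 1)
    (hn : K * (k * lam / ε * Real.log (1 / δ)) ≤ n)
    {z w : DataSet (3 * n) d} (hz : z ∈ goodSet n d lam) (hw : w ∈ goodSet n d lam)
    (hk : (dataDist z w : ℝ) ≤ k) {E : Set (EuclideanSpace ℝ (Fin d))} (hE : MeasurableSet E) :
    releaseGaussian (noiseScaleSq n ε δ lam k) z E
      ≤ ENNReal.ofReal (Real.exp (2 * ε)) * releaseGaussian (noiseScaleSq n ε δ lam k) w E
        + ENNReal.ofReal ((1 + Real.exp ε) * δ) := by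
  classical
  -- Distinct data sets force `k ≥ 1`; this gives the positivity of `k` and of the noise scale used
  -- below.
  by_cases hzw : z = w
  · rw [hzw]
    exact (indistinguishable_self (by linarith) _ E hE).1
  have hk1 : 1 ≤ k := by
    refine le_trans ?_ hk
    have : dataDist z w ≠ 0 := fun h => hzw (hammingDist_eq_zero.1 h)
    exact_mod_cast Nat.one_le_iff_ne_zero.2 this
  rcases Nat.eq_zero_or_pos d with rfl | hd
  · rcases E.eq_empty_or_nonempty with rfl | h
    · simp
    · rw [Subsingleton.eq_univ_of_nonempty h, measure_univ, measure_univ, mul_one]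
      exact (ENNReal.one_le_ofReal.2 (Real.one_le_exp (by linarith))).trans le_self_add
  obtain ⟨A, B, D, hBA, hD, hA1, hA2⟩ :=
    exists_simultaneous_diagonalization (empCov_posDef hz.1) (empCov_posDef hw.1)
  set L := Real.log (1 / δ) with hL
  have hexpL : Real.exp (-L) = δ := by rw [hL, one_div, Real.log_inv, neg_neg, Real.exp_log hδ]
  have he1 : 1 ≤ Real.exp ε := Real.one_le_exp hε.le
  have hL2 : 2 * ε < L := by
    have h1 : Real.exp (2 * ε + -L) < Real.exp 0 := by
      rw [Real.exp_add, hexpL, Real.exp_zero, two_mul, Real.exp_add]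
      have : 0 < Real.exp ε * δ := by positivity
      linarith
    have := Real.exp_lt_exp.1 h1
    linarith
  -- From `e^ε (1 + e^ε) ≥ 2` it follows that `δ < 1 / 2`, so `L > log 2`.
  have hLlog : 1 / 2 < L := by
    have h1 : Real.exp (Real.log 2 + -L) < Real.exp 0 := by
      rw [Real.exp_add, hexpL, Real.exp_zero, Real.exp_log two_pos]
      refine lt_of_le_of_lt (mul_le_mul_of_nonneg_right ?_ hδ.le) hsmall
      nlinarith
    have := Real.exp_lt_exp.1 h1
    linarith [Real.log_two_gt_d9]
  have hL0 : 0 < L := by linarith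
  obtain ⟨hn0, hlam1⟩ := pos_and_one_le_of_mem_goodSet hd hz
  have hn' : (0 : ℝ) < n := by exact_mod_cast hn0
  have hlam0 : 0 < lam := by linarith
  set γ := 2 * k * lam / n with hγ
  obtain ⟨hγL, hγ1⟩ := gamma_bounds hn' hK (by linarith) hlam0 hε hL2 hn hγ
  obtain ⟨hcov, hmean⟩ := whitened_bounds hd hBA hD hA1 hA2 hz hw hk hγ (by linarith)
  have hT0 : 0 ≤ ∑ i, |1 - 1 / D i| := Finset.sum_nonneg fun i _ => abs_nonneg _
  have hY0 : 0 ≤ ∑ i, (B.mulVec (empMean z - empMean w).ofLp) i ^ 2 :=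
    Finset.sum_nonneg fun i _ => sq_nonneg _
  have hX0 : 0 < lam / (1 - γ) := div_pos hlam0 (by linarith)
  have hLl : L ≤ Real.log (1.25 / δ) := Real.log_le_log (by positivity) (by gcongr; norm_num)
  have hC : noiseScaleSq n ε δ lam k
      = 32 * k ^ 2 / (ε ^ 2 * (n : ℝ) ^ 2) * (lam / (1 - γ)) * Real.log (1.25 / δ) := rfl
  have hC0 : 0 < noiseScaleSq n ε δ lam k := by
    have h1 : 0 < Real.log (1.25 / δ) := by linarith
    rw [hC]
    positivity
  have hα1 : 1 ≤ 2 * L / ε := by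
    rw [le_div_iff₀ hε]
    linarith
  obtain ⟨hsm, hcov'⟩ := covariance_loss_bounds hε hLlog rfl hT0 hγL hcov
  have hfin := multivariateGaussian_le (empMean z) (empMean w) hBA hD hC0 hα1 hδ
    (mean_loss_bound hn' hε hL0 hLl rfl hα1 hγ1 hY0 hC hC0 hmean) hsm hcov' hE
  rwa [hA1, hA2] at hfin

theorem corollary4p12 :
    ∃ K₀ : ℝ, 0 < K₀ ∧
      ∀ (K c : ℝ) (n d : ℕ) (ε δ β : ℝ)
        (proj : DataSet (3 * n) d → DataSet (3 * n) d),
        K₀ ≤ K → 0 < c → 0 < ε → 0 < δ → δ < 1 → 0 < β →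
        IsProjection (goodSet n d (lamParam c n d β)) proj →
        IsDifferentiallyPrivate Neighboring
            (3 * ε) (Real.exp ε * (1 + Real.exp ε) * δ) (rescaledGaussian K c ε δ β proj) ∧
          IsDifferentiallyPrivate MultisetNeighboring
            (3 * ε) (Real.exp ε * (1 + Real.exp ε) * δ) (rescaledGaussian K c ε δ β proj) := by
  refine ⟨100, by norm_num, fun K c n d ε δ β proj hK _ hε hδ hδ1 hβ hp => ?_⟩
  have h := isDifferentiallyPrivate_rescaledGaussian_of_releaseGaussian (K := K) hε hδ hδ1 hβ hp
    fun hsmall hn z hz w hw hk E hE => releaseGaussian_le hK hε hδ hsmall hn hz hw hk hE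
  exact ⟨h, isDifferentiallyPrivate_multiset_of_neighboring h⟩
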